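/- A vocabulary is a set of $n$ Boolean variables. A transition system $(\mathit{Init},\delta,\mathit{Bad})$ consists of propositional formulas $\mathit{Init},\mathit{Bad}$ over the vocabulary and $\delta$ over the vocabulary and a primed copy of it; an inductive invariant is a formula $I$ with $\mathit{Init}\Rightarrow I$, $I\wedge\delta\Rightarrow I'$ and $I\Rightarrow\neg\mathit{Bad}$. $\mathrm{CNF}_m$ is the set of CNF formulas with at most $m$ clauses, and $\mathrm{MonCNF}_m$ its subset in which all literals are negative. For a polynomial $p$ (with rational coefficients) such that $p(n)=\Omega(n)$, polynomial-length inference for a class of systems is the problem to decide, for a system of the class with vocabulary size $n$, whether it has an inductive invariant in $\mathrm{CNF}_{p(n)}$. For $k\in\mathbb N$ take the vocabulary $\{y_1,\dots,y_k,x_1,\dots,x_k,a,b,e\}$ of size $n=2k+3$, $\mathit{Init}_k = (\vec y=\vec 0\wedge\vec x=\vec 0\wedge\neg a\wedge b\wedge\neg e)$ and $\mathit{Bad}_k=e$. Let $\mathcal M_{\mathrm{bad}}$ be the class of all systems $(\mathit{Init}_k,\ \varphi\to\varphi',\ \mathit{Bad}_k)$ with $\varphi\in\mathrm{MonCNF}_{2k+1}$,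 $\mathit{Init}_k\Rightarrow\varphi$ and $\varphi\Rightarrow\neg\mathit{Bad}_k$, together with the systems $(\mathit{Init}_k,\mathit{true},\mathit{Bad}_k)$, for all $k\in\mathbb N$. A query algorithm is given the vocabulary, $\mathit{Init}$ and $\mathit{Bad}$, and has access to $\delta$ only through an oracle; its query complexity at $n$ is the supremum, over the admissible oracles and the systems of the class with vocabulary size $n$, of the number of its queries. In the Hoare-query model a query $(\alpha,\beta)$ is answered *false* if $\alpha\wedge\delta\wedge\neg\beta'$ is satisfiable and *true* otherwise. In the inductiveness-query (ICE-style) model a query is a formula $\alpha$ with $\mathit{Init}\Rightarrow\alpha$ and $\alpha\Rightarrow\neg\mathit{Bad}$, answered *true* if $\alpha\wedge\delta\Rightarrow\alpha'$ and otherwise by some pair $(\sigma,\sigma')\models\alpha\wedge\delta\wedge\neg\alpha'$; the admissible oracles are all that answer in this way, and the algorithm has to be correct with each of them. PDR-1 is the following Hoare-query algorithm. Start with $I:=\neg\mathit{Bad}$. While the query $(I,I)$ is answered *false*, find a transition $(\sigma,\sigma')\models I\wedge\delta\wedge\neg I'$ by fixing the variables one at a time, with one query for each; let $d$ be the cube of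 $\sigma$; for each literal $l$ of this cube in turn, drop $l$ from $d$ if the remaining conjunction $t$ satisfies $\mathit{Init}\Rightarrow\neg t$ and the query $(\mathit{Init},\neg t)$ is answered *true*; then replace $I$ by $I\wedge\neg d$. Return $I$. **Theorem.** Let $p$ be a polynomial with rational coefficients and $p(n)=\Omega(n)$. 1. The algorithm that runs PDR-1 with at most $\max(0,\lfloor p(n)\rfloor)$ strengthenings of $I$ and answers *yes* if and only if PDR-1 returns a formula that is equivalent to one in $\mathrm{CNF}_{p(n)}$ and is an inductive invariant decides polynomial-length inference for $\mathcal M_{\mathrm{bad}}$ in the Hoare-query model, and its query complexity is at most a polynomial in $n$. 2. Polynomial-length inference for $\mathcal M_{\mathrm{bad}}$ can be decided in time polynomial in $n$ by a machine with access to the Hoare-query oracle, where each oracle call counts as one step. 3. Every algorithm in the inductiveness-query model, even a computationally unrestricted one, that decides polynomial-length inference for $\mathcal M_{\mathrm{bad}}$ has query complexity $2^{\Omega(n)}$: there are $c>0$ and $k_0$ such that for every such algorithm and all $k\ge k_0$ its query complexity at $n=2k+3$ is at least $2^{cn}$. -/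

import Mathlib

/-! ## Propositional formulas, transition systems, inductive invariants -/

/-- Propositional formulas over the variables `V`. -/
inductive PForm (V : Type) : Type
  | tru : PForm V
  | fls : PForm V
  | var : V → PForm V
  | neg : PForm V → PForm V
  | and : PForm V → PForm V → PForm V
  | or : PForm V → PForm V → PForm V
  | imp : PForm V → PForm V → PForm V

namespace PForm

/-- Truth value of a formula under a valuation. -/
def eval {V : Type} (s : V → Bool) : PForm V → Bool
  | tru => true
  | fls => false
  | var v => s v
  | neg f => !(f.eval s)
  | and f g => f.eval s && g.eval s
  | or f g => f.eval s || g.eval s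
  | imp f g => !(f.eval s) || g.eval s

/-- Renaming of variables. -/
def rename {V W : Type} (r : V → W) : PForm V → PForm W
  | tru => tru
  | fls => fls
  | var v => var (r v)
  | neg f => neg (f.rename r)
  | and f g => and (f.rename r) (g.rename r)
  | or f g => or (f.rename r) (g.rename r)
  | imp f g => imp (f.rename r) (g.rename r)

/-- Conjunction of a list of formulas (`tru` for the empty list). -/
def conj {V : Type} : List (PForm V) → PForm V
  | [] => tru
  | f :: l => and f (conj l)

/-- Disjunction of a list of formulas (`fls` for the empty list). -/
def disj {V : Type} : List (PForm V) → PForm V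
  | [] => fls
  | f :: l => or f (disj l)

/-- The literal `v` (for `(v, true)`) or `¬v` (for `(v, false)`). -/
def lit {V : Type} (l : V × Bool) : PForm V :=
  if l.2 then var l.1 else neg (var l.1)

/-- The formula in conjunctive normal form given by a list of clauses. -/
def ofClauses {V : Type} (cs : List (List (V × Bool))) : PForm V :=
  conj (cs.map fun c => disj (c.map lit))

/-- `f ⟹ g`: validity of the implication. -/
def Entails {V : Type} (f g : PForm V) : Prop :=
  ∀ s : V → Bool, f.eval s = true → g.eval s = true

/-- `CNF_m`: formulas in CNF with at most `m` clauses. -/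
def IsCNF {V : Type} (m : ℚ) (f : PForm V) : Prop :=
  ∃ cs : List (List (V × Bool)), (cs.length : ℚ) ≤ m ∧ f = ofClauses cs

/-- `MonCNF_m`: formulas in `CNF_m` all of whose literals are negative. -/
def IsMonCNF {V : Type} (m : ℚ) (f : PForm V) : Prop :=
  ∃ cs : List (List (V × Bool)), (cs.length : ℚ) ≤ m ∧
    (∀ c ∈ cs, ∀ l ∈ c, l.2 = false) ∧ f = ofClauses cs

end PForm

/-- A transition system over the vocabulary `{0, …, n-1}`. In the transition relation `delta` the
variable `Sum.inl v` is `v` in the pre-state, `Sum.inr v` is its copy `v'` for the post-state. -/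
structure TransSys (n : ℕ) where
  Init : PForm (Fin n)
  delta : PForm (Fin n ⊕ Fin n)
  Bad : PForm (Fin n)

/-- `α ∧ δ ⟹ β'`. -/
def HoareValid {n : ℕ} (delta : PForm (Fin n ⊕ Fin n)) (α β : PForm (Fin n)) : Prop :=
  ∀ s s' : Fin n → Bool,
    α.eval s = true → delta.eval (Sum.elim s s') = true → β.eval s' = true

/-- `I` is an inductive invariant of `T`. -/
def TransSys.IsInvariant {n : ℕ} (T : TransSys n) (I : PForm (Fin n)) : Prop :=
  T.Init.Entails I ∧ HoareValid T.delta I I ∧ I.Entails T.Bad.neg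

/-- `T` has an inductive invariant in `CNF_{p(n)}`. -/
def TransSys.HasShortInvariant {n : ℕ} (p : Polynomial ℚ) (T : TransSys n) : Prop :=
  ∃ I : PForm (Fin n), I.IsCNF (p.eval (n : ℚ)) ∧ T.IsInvariant I

/-! ## The monotone maximal systems -/

/-- The transition relation `φ → φ'`. -/
def maxTr {n : ℕ} (φ : PForm (Fin n)) : PForm (Fin n ⊕ Fin n) :=
  (φ.rename Sum.inl).imp (φ.rename Sum.inr)

/-! The vocabulary `y_1, …, y_k, x_1, …, x_k, a, b, e`, numbered in this order. -/

def varY (k : ℕ) (i : Fin k) : Fin (2 * k + 3) := ⟨i, by omega⟩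

def varX (k : ℕ) (i : Fin k) : Fin (2 * k + 3) := ⟨k + i, by omega⟩

def varA (k : ℕ) : Fin (2 * k + 3) := ⟨2 * k, by omega⟩

def varB (k : ℕ) : Fin (2 * k + 3) := ⟨2 * k + 1, by omega⟩

def varE (k : ℕ) : Fin (2 * k + 3) := ⟨2 * k + 2, by omega⟩

/-- `y = 0 ∧ x = 0 ∧ ¬a ∧ b ∧ ¬e`. -/
def initK (k : ℕ) : PForm (Fin (2 * k + 3)) :=
  PForm.conj
    [PForm.conj ((List.finRange k).map fun i => (PForm.var (varY k i)).neg),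
     PForm.conj ((List.finRange k).map fun i => (PForm.var (varX k i)).neg),
     (PForm.var (varA k)).neg, PForm.var (varB k), (PForm.var (varE k)).neg]

/-- The bad states are those with `e`. -/
def badK (k : ℕ) : PForm (Fin (2 * k + 3)) := PForm.var (varE k)

/-- The class of monotone maximal systems: `(Init_k, φ → φ', Bad_k)` for `φ ∈ MonCNF_{2k+1}` with
`Init_k ⟹ φ ⟹ ¬Bad_k`, and the unsafe systems `(Init_k, true, Bad_k)`, for all `k`. -/
inductive MonMaxSys : (n : ℕ) → TransSys n → Prop
  | maximal (k : ℕ) (φ : PForm (Fin (2 * k + 3))) (hmon : φ.IsMonCNF ((2 * k + 1 : ℕ) : ℚ))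
      (hinit : (initK k).Entails φ) (hbad : φ.Entails (badK k).neg) :
      MonMaxSys (2 * k + 3) ⟨initK k, maxTr φ, badK k⟩
  | unsafeSys (k : ℕ) : MonMaxSys (2 * k + 3) ⟨initK k, PForm.tru, badK k⟩

/-! ## Inference with queries -/

/-- A query model: the types of queries and of answers for each vocabulary size, and the family of
admissible oracles, each of which maps a transition relation and a query to an answer. The family
may depend on the formulas `Init` and `Bad`. -/
structure QueryModel where
  Query : ℕ → Type
  Answer : ℕ → Type
  oracles : (n : ℕ) → (Init Bad : PForm (Fin n)) →
    Set (PForm (Fin n ⊕ Fin n) → Query n → Answer n)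

/-- The Hoare-query oracle: `false` iff `α ∧ δ ∧ ¬β'` is satisfiable. -/
noncomputable def hoareOracle {n : ℕ} (delta : PForm (Fin n ⊕ Fin n))
    (q : PForm (Fin n) × PForm (Fin n)) : Bool :=
  open Classical in decide (HoareValid delta q.1 q.2)

/-- The Hoare-query model, with its only oracle. -/
noncomputable def hoareModel : QueryModel where
  Query n := PForm (Fin n) × PForm (Fin n)
  Answer _ := Bool
  oracles _ _ _ := {hoareOracle}

/-- Inductiveness-query oracles, where `none` is the answer "inductive" and `some (σ, σ')` is a
counterexample to induction. Answers to candidates that violate `Init ⟹ α` or `α ⟹ ¬Bad` are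
unspecified. -/
def IsInductivenessOracle {n : ℕ} (Init Bad : PForm (Fin n))
    (Q : PForm (Fin n ⊕ Fin n) → PForm (Fin n) → Option ((Fin n → Bool) × (Fin n → Bool))) :
    Prop :=
  ∀ (delta : PForm (Fin n ⊕ Fin n)) (α : PForm (Fin n)),
    Init.Entails α → α.Entails Bad.neg →
      (HoareValid delta α α → Q delta α = none) ∧
      (¬ HoareValid delta α α → ∃ s s' : Fin n → Bool, Q delta α = some (s, s') ∧
        α.eval s = true ∧ delta.eval (Sum.elim s s') = true ∧ α.eval s' = false)

/-- The inductiveness-query model, with the family of all inductiveness-query oracles. -/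
def inductivenessModel : QueryModel where
  Query n := PForm (Fin n)
  Answer n := Option ((Fin n → Bool) × (Fin n → Bool))
  oracles _ Init Bad := {Q | IsInductivenessOracle Init Bad Q}

/-- A (computationally unrestricted) decision algorithm in a query model: given the vocabulary,
`Init`, `Bad` and the answers received so far (in order), it asks the next query or stops with a
verdict. It has no other access to the transition relation. -/
abbrev QueryAlg (M : QueryModel) : Type :=
  (n : ℕ) → (Init Bad : PForm (Fin n)) → List (M.Answer n) → M.Query n ⊕ Bool

/-- `QueryRun step O h b m`: from the answer history `h`, the strategy `step` with the answering
function `O` stops with verdict `b` after exactly `m` further queries. -/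
inductive QueryRun {Q R : Type} (step : List R → Q ⊕ Bool) (O : Q → R) :
    List R → Bool → ℕ → Prop
  | halt (h : List R) (b : Bool) (hs : step h = Sum.inr b) : QueryRun step O h b 0
  | ask (h : List R) (q : Q) (b : Bool) (m : ℕ) (hs : step h = Sum.inl q)
      (hr : QueryRun step O (h ++ [O q]) b m) : QueryRun step O h b (m + 1)

/-- The number of queries of `A` on `T` with the oracle `Q` (`⊤` if `A` does not stop). -/
noncomputable def queryCount {M : QueryModel} (A : QueryAlg M) {n : ℕ} (T : TransSys n)
    (Q : PForm (Fin n ⊕ Fin n) → M.Query n → M.Answer n) : ℕ∞ :=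
  ⨅ (m : ℕ) (_ : ∃ b : Bool, QueryRun (A n T.Init T.Bad) (Q T.delta) [] b m), (m : ℕ∞)

/-- The query complexity: worst case over the oracles in the family and the systems of the class
with vocabulary size `n`. -/
noncomputable def queryComplexity {M : QueryModel} (A : QueryAlg M)
    (P : (n : ℕ) → TransSys n → Prop) (n : ℕ) : ℕ∞ :=
  ⨆ (T : TransSys n) (_ : P n T) (Q ∈ M.oracles n T.Init T.Bad), queryCount A T Q

/-- `A` decides, on the class `P` and with every oracle of the model, whether there is an inductive
invariant in `CNF_{p(n)}`. -/
def DecidesInference {M : QueryModel} (A : QueryAlg M) (p : Polynomial ℚ)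
    (P : (n : ℕ) → TransSys n → Prop) : Prop :=
  ∀ (n : ℕ) (T : TransSys n), P n T → ∀ Q ∈ M.oracles n T.Init T.Bad,
    ∃ (b : Bool) (m : ℕ), QueryRun (A n T.Init T.Bad) (Q T.delta) [] b m ∧
      (b = true ↔ T.HasShortInvariant p)

/-! ## PDR-1 -/

/-- Computations that ask Hoare queries over the vocabulary `{0, …, n-1}`. -/
inductive HoareComp (n : ℕ) (A : Type) : Type
  | ret (a : A) : HoareComp n A
  | ask (α β : PForm (Fin n)) (next : Bool → HoareComp n A) : HoareComp n A

namespace HoareComp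

def bind {n : ℕ} {A B : Type} : HoareComp n A → (A → HoareComp n B) → HoareComp n B
  | ret a, f => f a
  | ask α β next, f => ask α β fun r => (next r).bind f

/-- The strategy that carries out a computation. -/
def toStrategy {n : ℕ} {A : Type} :
    HoareComp n A → List Bool → (PForm (Fin n) × PForm (Fin n)) ⊕ A
  | ret a, _ => Sum.inr a
  | ask α β _, [] => Sum.inl (α, β)
  | ask _ _ next, r :: h => (next r).toStrategy h

end HoareComp

/-- Finds the values of the listed pre-state and post-state variables in a transition that violates
the Hoare triple `{α} δ {β}`, one variable and one query at a time. `v` holds the values so far. -/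
def ctiLoop {n : ℕ} : List (Fin n ⊕ Fin n) → (α β : PForm (Fin n)) → (v : Fin n ⊕ Fin n → Bool) →
    HoareComp n (Fin n ⊕ Fin n → Bool)
  | [], _, _, v => .ret v
  | Sum.inl x :: l, α, β, v =>
      .ask (α.and (.var x)) β fun r =>
        if r = false then ctiLoop l (α.and (.var x)) β (Function.update v (Sum.inl x) true)
        else ctiLoop l (α.and (PForm.var x).neg) β (Function.update v (Sum.inl x) false)
  | Sum.inr x :: l, α, β, v =>
      .ask α (β.or (PForm.var x).neg) fun r =>
        if r = false then
          ctiLoop l α (β.or (PForm.var x).neg) (Function.update v (Sum.inr x) true)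
        else ctiLoop l α (β.or (.var x)) (Function.update v (Sum.inr x) false)

/-- If `{α} δ {β}` is violated, finds a violating transition `(σ, σ')`. -/
def findCTI {n : ℕ} (α β : PForm (Fin n)) : HoareComp n ((Fin n → Bool) × (Fin n → Bool)) :=
  (ctiLoop ((List.finRange n).map Sum.inl ++ (List.finRange n).map Sum.inr) α β
    fun _ => false).bind fun v => .ret (fun x => v (Sum.inl x), fun x => v (Sum.inr x))

/-- The literals of the cube of a state. -/
def cubeOf {n : ℕ} (s : Fin n → Bool) : List (Fin n × Bool) :=
  (List.finRange n).map fun x => (x, s x)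

/-- The conjunction of a list of literals. -/
def cubeForm {n : ℕ} (d : List (Fin n × Bool)) : PForm (Fin n) :=
  PForm.conj (d.map PForm.lit)

/-- Goes through the listed literals and drops each from the cube `d` if what remains holds in no
state that is reachable in at most one step. -/
noncomputable def blockLoop {n : ℕ} (Init : PForm (Fin n)) :
    List (Fin n × Bool) → (d : List (Fin n × Bool)) → HoareComp n (List (Fin n × Bool))
  | [], d => .ret d
  | l :: ls, d =>
      open Classical in
      if Init.Entails (cubeForm (d.erase l)).neg then
        .ask Init (cubeForm (d.erase l)).neg fun r =>
          if r = true then blockLoop Init ls (d.erase l) else blockLoop Init ls d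
      else blockLoop Init ls d

/-- The main loop of PDR-1 from the candidate `I`, with at most `fuel` strengthenings of the
candidate; `none` if these do not suffice. -/
noncomputable def pdr1Loop {n : ℕ} (Init : PForm (Fin n)) :
    (fuel : ℕ) → (I : PForm (Fin n)) → HoareComp n (Option (PForm (Fin n)))
  | 0, I => .ask I I fun r => .ret (if r = true then some I else none)
  | fuel + 1, I => .ask I I fun r =>
      if r = true then .ret (some I)
      else (findCTI I I).bind fun st =>
        (blockLoop Init (cubeOf st.1) (cubeOf st.1)).bind fun d =>
          pdr1Loop Init fuel (I.and (cubeForm d).neg)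

/-- PDR-1 with at most `fuel` strengthenings. -/
noncomputable def pdr1 {n : ℕ} (Init Bad : PForm (Fin n)) (fuel : ℕ) :
    HoareComp n (Option (PForm (Fin n))) :=
  pdr1Loop Init fuel Bad.neg

/-- The decision algorithm: run PDR-1 with at most `p(n)` strengthenings; answer *yes* iff it
returns a formula that has an equivalent in `CNF_{p(n)}` and is an inductive invariant. -/
noncomputable def pdr1Decide (p : Polynomial ℚ) : QueryAlg hoareModel :=
  fun n Init Bad =>
    ((pdr1 Init Bad ⌊p.eval (n : ℚ)⌋₊).bind fun res =>
      match res with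
      | none => .ret false
      | some I => .ask I I fun r =>
          open Classical in
          .ret (r && decide ((∃ J : PForm (Fin n), J.IsCNF (p.eval (n : ℚ)) ∧
            ∀ s, J.eval s = I.eval s) ∧ Init.Entails I ∧ I.Entails Bad.neg))).toStrategy

/-! ## Running time modulo the query oracle

Programs with finitely many stacks over a fixed finite alphabet (two stacks make up a tape of a
Turing machine). Every elementary instruction, test and oracle call takes one step, and an oracle
call is made on formulas that the program has written out symbol by symbol. -/

inductive Tok : Type
  | tt | ff | var | one | neg | and | or | imp

/-- Prefix notation; the variable `i` is written in unary. -/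
def PForm.encode {n : ℕ} : PForm (Fin n) → List Tok
  | .tru => [Tok.tt]
  | .fls => [Tok.ff]
  | .var i => List.replicate i.val Tok.one ++ [Tok.var]
  | .neg f => Tok.neg :: f.encode
  | .and f g => Tok.and :: (f.encode ++ g.encode)
  | .or f g => Tok.or :: (f.encode ++ g.encode)
  | .imp f g => Tok.imp :: (f.encode ++ g.encode)

theorem PForm.replicate_one_append_inj (i j : ℕ) (u v : List Tok)
    (h : List.replicate i Tok.one ++ Tok.var :: u = List.replicate j Tok.one ++ Tok.var :: v) :
    i = j ∧ u = v := by
  induction i generalizing j with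
  | zero => cases j <;> simp_all [List.replicate_succ]
  | succ i ih =>
    cases j with
    | zero => simp [List.replicate_succ] at h
    | succ j =>
      simp only [List.replicate_succ, List.cons_append, List.cons.injEq, true_and] at h
      exact ⟨congrArg _ (ih j h).1, (ih j h).2⟩

theorem PForm.encode_append_inj {n : ℕ} (f g : PForm (Fin n)) (u v : List Tok)
    (h : f.encode ++ u = g.encode ++ v) : f = g ∧ u = v := by
  induction f generalizing g u v with
  | tru => cases g with
    | var j => rcases j with ⟨_ | j, hj⟩ <;> simp [encode, List.replicate_succ] at h
    | _ => simp_all [encode]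
  | fls => cases g with
    | var j => rcases j with ⟨_ | j, hj⟩ <;> simp [encode, List.replicate_succ] at h
    | _ => simp_all [encode]
  | var i => cases g with
    | var j =>
      have := replicate_one_append_inj i.val j.val u v (by simpa [encode] using h)
      exact ⟨by rw [Fin.ext this.1], this.2⟩
    | _ => rcases i with ⟨_ | i, hi⟩ <;> simp [encode, List.replicate_succ] at h
  | neg f ih => cases g with
    | var j => rcases j with ⟨_ | j, hj⟩ <;> simp [encode, List.replicate_succ] at h
    | neg g =>
      have := ih g u v (by simpa [encode] using h)
      exact ⟨by rw [this.1], this.2⟩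
    | _ => simp [encode] at h
  | and f f' ih ih' => cases g with
    | var j => rcases j with ⟨_ | j, hj⟩ <;> simp [encode, List.replicate_succ] at h
    | and g g' =>
      have h₁ := ih g _ _ (by simpa [encode] using h)
      have h₂ := ih' g' _ _ h₁.2
      exact ⟨by rw [h₁.1, h₂.1], h₂.2⟩
    | _ => simp [encode] at h
  | or f f' ih ih' => cases g with
    | var j => rcases j with ⟨_ | j, hj⟩ <;> simp [encode, List.replicate_succ] at h
    | or g g' =>
      have h₁ := ih g _ _ (by simpa [encode] using h)
      have h₂ := ih' g' _ _ h₁.2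
      exact ⟨by rw [h₁.1, h₂.1], h₂.2⟩
    | _ => simp [encode] at h
  | imp f f' ih ih' => cases g with
    | var j => rcases j with ⟨_ | j, hj⟩ <;> simp [encode, List.replicate_succ] at h
    | imp g g' =>
      have h₁ := ih g _ _ (by simpa [encode] using h)
      have h₂ := ih' g' _ _ h₁.2
      exact ⟨by rw [h₁.1, h₂.1], h₂.2⟩
    | _ => simp [encode] at h

/-- A word encodes at most one formula. -/
theorem PForm.encode_injective {n : ℕ} :
    Function.Injective (PForm.encode : PForm (Fin n) → List Tok) := fun f g h =>
  (PForm.encode_append_inj f g [] [] (by simpa using h)).1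

/-- The contents of the registers, each of which is a stack (the head of the list is the top). -/
abbrev Store : Type := ℕ → List Tok

inductive Test : Type
  | nonempty (r : ℕ)
  | top (r : ℕ) (a : Tok)

def Test.Holds (s : Store) : Test → Prop
  | .nonempty r => s r ≠ []
  | .top r a => (s r).head? = some a

inductive Prog : Type
  | skip : Prog
  | push (r : ℕ) (a : Tok) : Prog
  | pop (r : ℕ) : Prog
  | query (u v r : ℕ) : Prog
  | seq (P₁ P₂ : Prog) : Prog
  | ite (c : Test) (P₁ P₂ : Prog) : Prog
  | loop (c : Test) (P : Prog) : Prog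

/-- `Exec O P s s' t`: from the store `s`, the program `P` with the oracle `O` halts in the store
`s'` after `t` steps. `Prog.query u v r` queries the oracle on the contents of the registers `u` and
`v` and pushes the answer onto the register `r`. -/
inductive Exec (O : List Tok → List Tok → Bool) : Prog → Store → Store → ℕ → Prop
  | skip (s : Store) : Exec O .skip s s 1
  | push (r : ℕ) (a : Tok) (s : Store) :
      Exec O (.push r a) s (Function.update s r (a :: s r)) 1
  | pop (r : ℕ) (s : Store) :
      Exec O (.pop r) s (Function.update s r (s r).tail) 1
  | query (u v r : ℕ) (s : Store) :
      Exec O (.query u v r) s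
        (Function.update s r ((if O (s u) (s v) = true then Tok.tt else Tok.ff) :: s r)) 1
  | seq (P₁ P₂ : Prog) (s s' s'' : Store) (t t' : ℕ) (h : Exec O P₁ s s' t)
      (h' : Exec O P₂ s' s'' t') : Exec O (.seq P₁ P₂) s s'' (t + t')
  | ite_pos (c : Test) (P₁ P₂ : Prog) (s s' : Store) (t : ℕ) (hc : c.Holds s)
      (h : Exec O P₁ s s' t) : Exec O (.ite c P₁ P₂) s s' (t + 1)
  | ite_neg (c : Test) (P₁ P₂ : Prog) (s s' : Store) (t : ℕ) (hc : ¬ c.Holds s)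
      (h : Exec O P₂ s s' t) : Exec O (.ite c P₁ P₂) s s' (t + 1)
  | loop_stop (c : Test) (P : Prog) (s : Store) (hc : ¬ c.Holds s) :
      Exec O (.loop c P) s s 1
  | loop_step (c : Test) (P : Prog) (s s' s'' : Store) (t t' : ℕ) (hc : c.Holds s)
      (h : Exec O P s s' t) (h' : Exec O (.loop c P) s' s'' t') :
      Exec O (.loop c P) s s'' (t + t' + 1)

/-- The Hoare-query oracle on words that encode formulas. On other words it answers `true`. -/
noncomputable def wordOracle {n : ℕ} (delta : PForm (Fin n ⊕ Fin n)) (u v : List Tok) : Bool :=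
  open Classical in
  decide (∀ α β : PForm (Fin n), α.encode = u → β.encode = v → hoareOracle delta (α, β) = true)

/-- The input: the vocabulary size in unary, `Init` and `Bad` in the registers 0, 1 and 2. -/
def inputStore {n : ℕ} (T : TransSys n) : Store
  | 0 => List.replicate n Tok.one
  | 1 => T.Init.encode
  | 2 => T.Bad.encode
  | _ => []

/-- The program `P` decides on the class, with the Hoare-query oracle and in a number of steps
polynomial in the vocabulary size, whether there is an inductive invariant in `CNF_{p(n)}`. The
verdict is the top of register 0. -/
def DecidesInPolyTime (P : Prog) (p : Polynomial ℚ) (C : (n : ℕ) → TransSys n → Prop) : Prop :=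
  ∃ r : Polynomial ℕ, ∀ (n : ℕ) (T : TransSys n), C n T →
    ∃ (s : Store) (t : ℕ), Exec (wordOracle T.delta) P (inputStore T) s t ∧ t ≤ r.eval n ∧
      (T.HasShortInvariant p → (s 0).head? = some Tok.tt) ∧
      (¬ T.HasShortInvariant p → (s 0).head? = some Tok.ff)

/-! For a maximal system the inductive invariants are exactly the formulas equivalent to `φ`
(`isInvariant_maxTr_iff`), so inference asks for the length of a shortest CNF of `φ`. Since `φ` is
antitone, this length is governed by its minimal non-models: each is the set of negated variables of
some clause of every equivalent CNF, monotone or not (`PForm.length_le_of_minFalse`). The unsafe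
systems have no invariant at all.

Hoare queries reveal `φ`: on a maximal system, `(α, ¬Bad)` tests `α ⟹ φ` and `(Init, β)` tests `φ ⟹
β`. The pre-state of a counterexample found by PDR-1 is a non-model of `φ`, and dropping literals
shrinks it to a minimal non-model that no earlier clause excludes (`exists_minFalse_strengthening`).
Hence there are at most as many strengthenings as clauses in any CNF of `φ` (`result_pdr1Loop`).
PDR-1 as used here ends with an unbounded test for a short equivalent formula. The polynomial-time
program avoids it: it learns one clause for each minimal non-model, at most `2k+1` in all, by a
greedy search with queries `(α, ¬Bad)`. When the clauses entail `φ` they form a shortest CNF, so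
comparing their number with `p(n)` gives the verdict (`hasShortInvariant_iff_of_minFalse`).

For the lower bound an adversary counts in binary through `x`, along a chain of `2^K` states
followed by a bad one. A candidate that holds initially and excludes `Bad` is lost somewhere on the
chain, and the adversary answers with that step. The formula "the number is at most `v`" is a
monotone CNF with at most `K+1` clauses, and its maximal system forbids only the chain step from `v`
to `v+1`. Each answer thus rules out at most one `v`, and with fewer than `2^K` queries some safe
system with a short invariant is not told apart from the unsafe one (`two_pow_le_queryComplexity`).
Taking `K` proportional to `n`, with `K + 1 ≤ p(n)`, gives the exponential bound. -/

/-! ### Antitone formulas and their minimal non-models -/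

namespace PForm

variable {V : Type}

theorem eval_conj (s : V → Bool) (l : List (PForm V)) :
    (conj l).eval s = true ↔ ∀ f ∈ l, f.eval s = true := by
  induction l <;> simp_all [conj, eval]

theorem eval_disj (s : V → Bool) (l : List (PForm V)) :
    (disj l).eval s = true ↔ ∃ f ∈ l, f.eval s = true := by
  induction l <;> simp_all [disj, eval]

theorem eval_lit (s : V → Bool) (l : V × Bool) : (lit l).eval s = true ↔ s l.1 = l.2 := by
  rcases l with ⟨v, _ | _⟩ <;> simp [lit, eval]

theorem eval_ofClauses (s : V → Bool) (cs : List (List (V × Bool))) :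
    (ofClauses cs).eval s = true ↔ ∀ c ∈ cs, ∃ l ∈ c, s l.1 = l.2 := by
  simp only [ofClauses, eval_conj, eval_disj, List.mem_map, forall_exists_index, and_imp,
    forall_apply_eq_imp_iff₂, exists_exists_and_eq_and, eval_lit]

theorem eval_rename {W : Type} (r : V → W) (s : W → Bool) (f : PForm V) :
    (f.rename r).eval s = f.eval (s ∘ r) := by
  induction f <;> simp_all [rename, eval]

/-- The set of models is closed under switching variables off. -/
def IsAntitone (f : PForm V) : Prop :=
  ∀ s t : V → Bool, s ≤ t → f.eval t = true → f.eval s = true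

theorem IsMonCNF.isAntitone {m : ℚ} {f : PForm V} (hf : f.IsMonCNF m) : f.IsAntitone := by
  obtain ⟨cs, -, hneg, rfl⟩ := hf
  intro s t hst ht
  rw [eval_ofClauses] at ht ⊢
  intro c hc
  obtain ⟨l, hl, h⟩ := ht c hc
  refine ⟨l, hl, ?_⟩
  rw [hneg c hc l hl] at h ⊢
  have := hst l.1
  rw [h] at this
  exact le_bot_iff.1 this

/-- `σ` is a minimal non-model. -/
def MinFalse [DecidableEq V] (f : PForm V) (σ : V → Bool) : Prop :=
  f.eval σ = false ∧ ∀ x, σ x = true → f.eval (Function.update σ x false) = true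

theorem IsAntitone.eq_false_of_le {f : PForm V} (hf : f.IsAntitone) {s t : V → Bool}
    (hst : s ≤ t) (hs : f.eval s = false) : f.eval t = false := by
  by_contra h
  have := hf s t hst (by simpa using h)
  simp_all

/-- A minimal non-model `σ` falsifies some clause, and `σ` is then precisely the set of variables
negated in that clause. So distinct minimal non-models come from distinct clauses. The clauses may
contain positive literals; only the function they define has to be antitone. -/
theorem length_le_of_minFalse [DecidableEq V] {f : PForm V} (hf : f.IsAntitone)
    (cs : List (List (V × Bool))) (hcs : ∀ s, (ofClauses cs).eval s = f.eval s)
    (L : List (V → Bool)) (hL : L.Nodup) (hmin : ∀ σ ∈ L, f.MinFalse σ) :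
    L.length ≤ cs.length := by
  classical
  have hsub : L ⊆ cs.map fun c v => decide ((v, false) ∈ c) := by
    intro σ hσ
    obtain ⟨h0, h1⟩ := hmin σ hσ
    have hfalse : ¬ (ofClauses cs).eval σ = true := by rw [hcs, h0]; simp
    rw [eval_ofClauses] at hfalse
    push Not at hfalse
    obtain ⟨c, hc, hcl⟩ := hfalse
    refine List.mem_map.2 ⟨c, hc, ?_⟩
    have hle : (fun v => decide ((v, false) ∈ c)) ≤ σ := by
      intro v
      by_cases hv : (v, false) ∈ c
      · have := hcl _ hv
        simp_all
      · simp [hv]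
    -- The state supported on the negated variables of `c` falsifies `c` as well: a variable
    -- positive in `c` is off in `σ`, hence off in this smaller state.
    have hgf : f.eval (fun v => decide ((v, false) ∈ c)) = false := by
      rw [← hcs]
      by_contra h
      obtain ⟨⟨v, b⟩, hl, hvb⟩ := (eval_ofClauses _ _).1 (by simpa using h) c hc
      cases b
      · simp [hl] at hvb
      · have h2 := hcl _ hl
        have h3 := hle v
        simp only at hvb h2
        simp_all
    -- If this non-model were strictly below `σ`, it would lie below `σ` with one variable switched
    -- off, which is a model.
    by_contra hne
    obtain ⟨x, hx⟩ := Function.ne_iff.1 hne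
    have hlex := hle x
    have hσx : σ x = true := by
      by_contra h
      simp_all
    have hgx : decide ((x, false) ∈ c) = false := by
      by_contra h
      simp_all
    have : (fun v => decide ((v, false) ∈ c)) ≤ Function.update σ x false := by
      intro v
      by_cases hv : v = x
      · subst hv; simp [hgx]
      · simpa [Function.update_of_ne hv] using hle v
    have := hf _ _ this (h1 x hσx)
    simp_all
  simpa using (List.subperm_of_subset hL hsub).length_le

end PForm

/-! ### Hoare queries and invariants of maximal systems -/

theorem hoareValid_congr {n : ℕ} {δ : PForm (Fin n ⊕ Fin n)} {I J : PForm (Fin n)}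
    (h : ∀ s, I.eval s = J.eval s) : HoareValid δ I I ↔ HoareValid δ J J := by
  simp [HoareValid, h]

theorem eval_maxTr {n : ℕ} (φ : PForm (Fin n)) (s s' : Fin n → Bool) :
    (maxTr φ).eval (Sum.elim s s') = true ↔ (φ.eval s = true → φ.eval s' = true) := by
  simp only [maxTr, PForm.eval, PForm.eval_rename, Sum.elim_comp_inl, Sum.elim_comp_inr]
  cases φ.eval s <;> simp

/-- A non-model of `φ` has transitions to all states, bad ones included, whereas models of `φ` only
lead to models of `φ`. -/
theorem hoareValid_maxTr_neg_bad {n : ℕ} {φ bad : PForm (Fin n)} (hφ : φ.Entails bad.neg)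
    (hbad : ∃ s, bad.eval s = true) (α : PForm (Fin n)) :
    HoareValid (maxTr φ) α bad.neg ↔ α.Entails φ := by
  obtain ⟨sb, hsb⟩ := hbad
  constructor
  · intro h s hs
    by_contra hn
    have := h s sb hs ((eval_maxTr _ _ _).2 fun h' => absurd h' hn)
    simp [PForm.eval, hsb] at this
  · intro h s s' hs hd
    exact hφ s' ((eval_maxTr _ _ _).1 hd (h s hs))

/-- An initial state is a model of `φ`, so its successors are exactly the models of `φ`. -/
theorem hoareValid_maxTr_init {n : ℕ} {φ init : PForm (Fin n)} (hφ : init.Entails φ)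
    (hinit : ∃ s, init.eval s = true) (β : PForm (Fin n)) :
    HoareValid (maxTr φ) init β ↔ φ.Entails β := by
  obtain ⟨s0, hs0⟩ := hinit
  constructor
  · intro h s hs
    exact h s0 s hs0 ((eval_maxTr _ _ _).2 fun _ => hs)
  · intro h s s' hs hd
    exact h s' ((eval_maxTr _ _ _).1 hd (hφ s hs))

/-- The invariants of a maximal system are the formulas equivalent to `φ`. -/
theorem isInvariant_maxTr_iff {n : ℕ} {φ init bad : PForm (Fin n)} (hi : init.Entails φ)
    (hb : φ.Entails bad.neg) (hinit : ∃ s, init.eval s = true) (hbad : ∃ s, bad.eval s = true)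
    (I : PForm (Fin n)) :
    (TransSys.mk init (maxTr φ) bad).IsInvariant I ↔ ∀ s, I.eval s = φ.eval s := by
  constructor
  · rintro ⟨h1, h2, h3⟩ s
    obtain ⟨s0, hs0⟩ := hinit
    -- An invariant never steps into `Bad`, so the query `(I, ¬Bad)` holds.
    have hIφ : I.Entails φ := (hoareValid_maxTr_neg_bad hb hbad I).1
      fun s s' hs hd => h3 s' (h2 s s' hs hd)
    have hφI : φ.Entails I := fun s hs =>
      h2 s0 s (h1 s0 hs0) ((eval_maxTr _ _ _).2 fun _ => hs)
    rw [Bool.eq_iff_iff]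
    exact ⟨hIφ s, hφI s⟩
  · intro h
    refine ⟨fun s hs => by rw [h]; exact hi s hs, ?_, fun s hs => hb s (by rw [← h]; exact hs)⟩
    intro s s' hs hd
    rw [h] at hs ⊢
    exact (eval_maxTr _ _ _).1 hd hs

theorem not_isInvariant_tru {n : ℕ} {init bad : PForm (Fin n)} (hinit : ∃ s, init.eval s = true)
    (hbad : ∃ s, bad.eval s = true) (I : PForm (Fin n)) :
    ¬ (TransSys.mk init PForm.tru bad).IsInvariant I := by
  rintro ⟨h1, h2, h3⟩
  obtain ⟨s0, hs0⟩ := hinit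
  obtain ⟨sb, hsb⟩ := hbad
  have := h3 sb (h2 s0 sb (h1 s0 hs0) rfl)
  simp [PForm.eval, hsb] at this

/-! ### Concrete states; safety fails for the unsafe systems -/

/-- The initial state with the values of `x` and `e` replaced. -/
def stateXE (k : ℕ) (x : ℕ → Bool) (e : Bool) (v : Fin (2 * k + 3)) : Bool :=
  if v.val < k then false
  else if v.val < 2 * k then x (v.val - k)
  else if v.val = 2 * k then false
  else if v.val = 2 * k + 1 then true
  else e

@[simp] theorem stateXE_varX (k : ℕ) (x : ℕ → Bool) (e : Bool) (i : Fin k) :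
    stateXE k x e (varX k i) = x i := by
  have := i.isLt
  have h : (varX k i).val = k + i := rfl
  simp only [stateXE, h]
  rw [if_neg (by omega), if_pos (by omega)]
  congr 1
  omega

@[simp] theorem stateXE_varE (k : ℕ) (x : ℕ → Bool) (e : Bool) :
    stateXE k x e (varE k) = e := by
  have h : (varE k).val = 2 * k + 2 := rfl
  simp only [stateXE, h]
  rw [if_neg (by omega), if_neg (by omega), if_neg (by omega), if_neg (by omega)]

theorem eval_badK (k : ℕ) (s : Fin (2 * k + 3) → Bool) : (badK k).eval s = s (varE k) := rfl

theorem eval_initK_stateXE (k : ℕ) : (initK k).eval (stateXE k (fun _ => false) false) = true := by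
  have hx (i : Fin k) := stateXE_varX k (fun _ => false) false i
  have hy (i : Fin k) : stateXE k (fun _ => false) false (varY k i) = false := by
    simp [stateXE, varY]
  have ha : stateXE k (fun _ => false) false (varA k) = false := by
    simp [stateXE, varA]
  have hb : stateXE k (fun _ => false) false (varB k) = true := by
    have h : (varB k).val = 2 * k + 1 := rfl
    simp only [stateXE, h]
    rw [if_neg (by omega), if_neg (by omega), if_neg (by omega), if_pos trivial]
  have he := stateXE_varE k (fun _ => false) false
  simp [initK, PForm.eval_conj, PForm.eval, hx, hy, ha, hb, he]

theorem exists_eval_initK (k : ℕ) : ∃ s, (initK k).eval s = true := ⟨_, eval_initK_stateXE k⟩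

theorem exists_eval_badK (k : ℕ) : ∃ s, (badK k).eval s = true := ⟨fun _ => true, rfl⟩

theorem not_hasShortInvariant_unsafe (k : ℕ) (p : Polynomial ℚ) :
    ¬ (TransSys.mk (initK k) PForm.tru (badK k)).HasShortInvariant p := by
  rintro ⟨I, -, hI⟩
  exact not_isInvariant_tru (exists_eval_initK k) (exists_eval_badK k) I hI

/-! ### Clearing denominators and signs of a rational polynomial -/

/-- A rational polynomial is, up to a positive factor, a difference of polynomials over `ℕ`. -/
theorem Polynomial.exists_nat_sub (p : Polynomial ℚ) :
    ∃ (D : ℕ) (P N : Polynomial ℕ), 0 < D ∧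
      ∀ n : ℕ, (D : ℚ) * p.eval (n : ℚ) = (P.eval n : ℕ) - (N.eval n : ℕ) := by
  induction p using Polynomial.induction_on' with
  | add p q hp hq =>
    obtain ⟨D, P, N, hD, h⟩ := hp
    obtain ⟨E, Q, M, hE, h'⟩ := hq
    refine ⟨D * E, P * C E + Q * C D, N * C E + M * C D, Nat.mul_pos hD hE, fun n => ?_⟩
    have h1 := h n
    have h2 := h' n
    simp only [eval_add, eval_mul, eval_C]
    push_cast
    linear_combination (E : ℚ) * h1 + (D : ℚ) * h2
  | monomial i q =>
    refine ⟨q.den, monomial i q.num.toNat, monomial i (-q.num).toNat, q.den_pos, fun n => ?_⟩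
    have h1 : ((q.num.toNat : ℚ)) - ((-q.num).toNat : ℚ) = q.num := by
      exact_mod_cast congrArg (Int.cast : ℤ → ℚ) (Int.toNat_sub_toNat_neg q.num)
    have h2 : (q.den : ℚ) * q = q.num := Rat.den_mul_eq_num q
    simp only [eval_monomial]
    push_cast
    rw [← mul_assoc, h2, ← h1]
    ring

/-! ### Binary comparison as a monotone CNF -/

/-- The most significant digit `d` at which `j` and `v` differ decides. If `v` has a zero there, the
condition fails at `i = d`; otherwise `d` serves as `i'` for every `i < d`, and above `d` the digits
agree. The right-hand side has one condition for each zero digit of `v` and only asks for zeros of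
`j`, which makes it a CNF with negative literals. -/
theorem Nat.le_iff_testBit {K j v : ℕ} (hj : j < 2 ^ K) (hv : v < 2 ^ K) :
    j ≤ v ↔ ∀ i < K, v.testBit i = false →
      j.testBit i = false ∨ ∃ i' < K, i < i' ∧ v.testBit i' = true ∧ j.testBit i' = false := by
  have hbit {m i : ℕ} (hm : m < 2 ^ K) (h : m.testBit i = true) : i < K := by
    by_contra hi
    have := Nat.testBit_lt_two_pow (hm.trans_le (Nat.pow_le_pow_right two_pos (not_lt.1 hi)))
    simp_all
  rcases eq_or_ne j v with rfl | hne
  · simp +contextual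
  obtain ⟨d, hd, hgt⟩ := Nat.exists_most_significant_bit (n := v ^^^ j)
    (by simpa [Nat.xor_eq_zero_iff] using hne.symm)
  have hd' : v.testBit d ≠ j.testBit d := by simpa using hd
  have hgt' : ∀ i, d < i → v.testBit i = j.testBit i := fun i hi => by simpa using hgt i hi
  cases hvd : v.testBit d
  · have hjd : j.testBit d = true := by simp_all
    refine iff_of_false (not_le.2 (Nat.lt_of_testBit d hvd hjd hgt')) fun h => ?_
    rcases h d (hbit hj hjd) hvd with h | ⟨i', -, hi', h1, h2⟩
    · simp_all
    · have := hgt' i' hi'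
      simp_all
  · have hjd : j.testBit d = false := by simp_all
    refine iff_of_true (Nat.lt_of_testBit d hjd hvd fun i hi => (hgt' i hi).symm).le ?_
    intro i _ hvi
    rcases lt_trichotomy i d with h | h | h
    · exact Or.inr ⟨d, hbit hv hvd, h, hvd, hjd⟩
    · simp_all
    · exact Or.inl (by rw [← hgt' i h, hvi])

/-- The clauses stating `¬e` and that the number with the binary digits `x_1, …, x_K` is at most
`v`. -/
def thresholdClauses {k K : ℕ} (hK : K ≤ k) (v : ℕ) : List (List (Fin (2 * k + 3) × Bool)) :=
  [(varE k, false)] ::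
    ((List.finRange K).filter fun i : Fin K => !v.testBit i).map fun i : Fin K =>
      (varX k (i.castLE hK), false) ::
        ((List.finRange K).filter fun j : Fin K => decide (i < j) && v.testBit j).map fun j : Fin K =>
          (varX k (j.castLE hK), false)

theorem length_thresholdClauses {k K : ℕ} (hK : K ≤ k) (v : ℕ) :
    (thresholdClauses hK v).length ≤ K + 1 := by
  have := List.length_filter_le (fun i : Fin K => !v.testBit i) (List.finRange K)
  simpa [thresholdClauses] using this

def thresholdForm {k K : ℕ} (hK : K ≤ k) (v : ℕ) : PForm (Fin (2 * k + 3)) :=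
  PForm.ofClauses (thresholdClauses hK v)

theorem eval_thresholdForm {k K : ℕ} (hK : K ≤ k) {j v : ℕ} (hj : j < 2 ^ K) (hv : v < 2 ^ K)
    (e : Bool) :
    (thresholdForm hK v).eval (stateXE k j.testBit e) = true ↔ e = false ∧ j ≤ v := by
  have hx (i : Fin K) : stateXE k j.testBit e (varX k (i.castLE hK)) = j.testBit i :=
    stateXE_varX k j.testBit e (i.castLE hK)
  rw [Nat.le_iff_testBit hj hv, thresholdForm, PForm.eval_ofClauses]
  simp only [thresholdClauses, List.mem_cons, forall_eq_or_imp, List.forall_mem_map, exists_eq_or_imp]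
  simp only [List.mem_map, List.mem_filter, List.mem_finRange, true_and, Bool.not_eq_true',
    stateXE_varE, exists_exists_and_eq_and, hx, Bool.and_eq_true, decide_eq_true_eq, List.not_mem_nil, false_and,
    exists_false, or_false]
  refine and_congr_right fun _ => ?_
  constructor
  · intro h i hi hvi
    refine (h ⟨i, hi⟩ hvi).imp id ?_
    rintro ⟨i', ⟨h1, h2⟩, h3⟩
    exact ⟨i', i'.isLt, h1, h2, h3⟩
  · intro h i hvi
    refine (h i i.isLt hvi).imp id ?_
    rintro ⟨i', hi', h1, h2, h3⟩
    exact ⟨⟨i', hi'⟩, ⟨h1, h2⟩, h3⟩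

theorem thresholdForm_entails {k K : ℕ} (hK : K ≤ k) (v : ℕ) :
    (thresholdForm hK v).Entails (badK k).neg := by
  intro s hs
  rw [thresholdForm, PForm.eval_ofClauses] at hs
  obtain ⟨l, hl, h⟩ := hs [(varE k, false)] (by simp [thresholdClauses])
  simp only [List.mem_singleton] at hl
  subst hl
  simpa [PForm.eval, badK] using h

theorem initK_entails_thresholdForm {k K : ℕ} (hK : K ≤ k) (v : ℕ) :
    (initK k).Entails (thresholdForm hK v) := by
  intro s hs
  simp only [initK, PForm.eval_conj, List.mem_cons, forall_eq_or_imp, List.forall_mem_map,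
    List.mem_finRange, PForm.eval, Bool.not_eq_true', forall_const] at hs
  obtain ⟨-, hx, -, -, he, -⟩ := hs
  rw [thresholdForm, PForm.eval_ofClauses]
  simp only [thresholdClauses, List.mem_cons, forall_eq_or_imp, List.forall_mem_map, exists_eq_or_imp]
  exact ⟨Or.inl he, fun i _ => Or.inl (hx _)⟩

theorem isMonCNF_thresholdForm {k K : ℕ} (hK : K ≤ k) (v : ℕ) :
    (thresholdForm hK v).IsMonCNF ((2 * k + 1 : ℕ) : ℚ) := by
  refine ⟨thresholdClauses hK v, ?_, ?_, rfl⟩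
  · have := length_thresholdClauses hK v
    exact_mod_cast (show (thresholdClauses hK v).length ≤ 2 * k + 1 by omega)
  · simp [thresholdClauses]

def thresholdSys {k K : ℕ} (hK : K ≤ k) (v : ℕ) : TransSys (2 * k + 3) :=
  ⟨initK k, maxTr (thresholdForm hK v), badK k⟩

theorem monMaxSys_thresholdSys {k K : ℕ} (hK : K ≤ k) (v : ℕ) :
    MonMaxSys (2 * k + 3) (thresholdSys hK v) :=
  .maximal k _ (isMonCNF_thresholdForm hK v) (initK_entails_thresholdForm hK v)
    (thresholdForm_entails hK v)

theorem hasShortInvariant_thresholdSys {k K : ℕ} (hK : K ≤ k) (v : ℕ) {p : Polynomial ℚ}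
    (hp : ((K + 1 : ℕ) : ℚ) ≤ p.eval ((2 * k + 3 : ℕ) : ℚ)) :
    (thresholdSys hK v).HasShortInvariant p := by
  refine ⟨thresholdForm hK v, ⟨_, ?_, rfl⟩, ?_⟩
  · exact le_trans (by exact_mod_cast length_thresholdClauses hK v) hp
  · exact (isInvariant_maxTr_iff (initK_entails_thresholdForm hK v) (thresholdForm_entails hK v)
      (exists_eval_initK k) (exists_eval_badK k) _).2 fun _ => rfl

/-! ### The chain adversary for inductiveness queries -/

/-- The states counting upwards in `x`, followed by a bad state. -/
def chainState (k K j : ℕ) : Fin (2 * k + 3) → Bool :=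
  -- From `2 ^ K` on, `e` makes the state bad whatever the digits are.
  stateXE k (if j < 2 ^ K then j.testBit else fun _ => true) (decide (2 ^ K ≤ j))

theorem eval_chainState {k K : ℕ} (hK : K ≤ k) {j v : ℕ} (hv : v < 2 ^ K) :
    (thresholdForm hK v).eval (chainState k K j) = true ↔ j ≤ v := by
  by_cases hj : j < 2 ^ K
  · simp [chainState, hj, eval_thresholdForm hK hj hv]
  · refine iff_of_false (fun h => ?_) (by omega)
    have := thresholdForm_entails hK v _ h
    simp [PForm.eval, badK, chainState, not_lt.1 hj] at this

theorem eval_initK_chainState_zero (k K : ℕ) : (initK k).eval (chainState k K 0) = true := by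
  have : (Nat.testBit 0) = fun _ => false := by funext i; simp
  simpa [chainState, this] using eval_initK_stateXE k

theorem eval_badK_chainState (k K : ℕ) : (badK k).eval (chainState k K (2 ^ K)) = true := by
  simp [chainState, eval_badK]

/-- The only step of the chain that leaves the threshold set starts at `v`, so exhibiting one step
of the chain excludes a single threshold. -/
theorem eval_maxTr_chainState {k K : ℕ} (hK : K ≤ k) {i v : ℕ} (hv : v < 2 ^ K) :
    (maxTr (thresholdForm hK v)).eval (Sum.elim (chainState k K i) (chainState k K (i + 1))) = true
      ↔ i ≠ v := by
  rw [eval_maxTr, eval_chainState hK hv, eval_chainState hK hv]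
  omega

/-- `α` holds in the `i`th state of the chain and fails in the next one. -/
def Separates {k : ℕ} (K : ℕ) (α : PForm (Fin (2 * k + 3))) (i : ℕ) : Prop :=
  i < 2 ^ K ∧ α.eval (chainState k K i) = true ∧ α.eval (chainState k K (i + 1)) = false

/-- A candidate holds at the initial end of the chain and fails at its bad end, so it is lost at
some step. -/
theorem exists_separates {k : ℕ} (K : ℕ) {α : PForm (Fin (2 * k + 3))}
    (h1 : (initK k).Entails α) (h2 : α.Entails (badK k).neg) : ∃ i, Separates K α i := by
  by_contra hno
  have key : ∀ i ≤ 2 ^ K, α.eval (chainState k K i) = true := by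
    intro i
    induction i with
    | zero => exact fun _ => h1 _ (eval_initK_chainState_zero k K)
    | succ i ih =>
      intro hi
      by_contra h
      exact hno ⟨i, hi, ih (by omega), by simpa using h⟩
  have := h2 _ (key _ le_rfl)
  simp [PForm.eval, eval_badK_chainState] at this

open Classical in
/-- The inductiveness oracle that answers with consecutive states of the chain if it can. -/
noncomputable def chainOracle (k K : ℕ) (δ : PForm (Fin (2 * k + 3) ⊕ Fin (2 * k + 3)))
    (α : PForm (Fin (2 * k + 3))) :
    Option ((Fin (2 * k + 3) → Bool) × (Fin (2 * k + 3) → Bool)) :=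
  -- The chosen index depends on `α` but not on `δ`, so that the answers for different systems can
  -- be compared.
  if h : ∃ i, Separates K α i then
    if δ.eval (Sum.elim (chainState k K h.choose) (chainState k K (h.choose + 1))) = true then
      some (chainState k K h.choose, chainState k K (h.choose + 1))
    else if h' : ∃ st : (Fin (2 * k + 3) → Bool) × (Fin (2 * k + 3) → Bool),
        α.eval st.1 = true ∧ δ.eval (Sum.elim st.1 st.2) = true ∧ α.eval st.2 = false then
      some h'.choose
    else none
  else none

theorem isInductivenessOracle_chainOracle (k K : ℕ) :
    IsInductivenessOracle (initK k) (badK k) (chainOracle k K) := by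
  intro δ α h1 h2
  have h := exists_separates K h1 h2
  obtain ⟨-, hs1, hs2⟩ := h.choose_spec
  rw [chainOracle, dif_pos h]
  constructor
  · intro hv
    rw [if_neg, dif_neg]
    · rintro ⟨st, ha, hd, hb⟩
      have := hv _ _ ha hd
      simp_all
    · intro hd
      have := hv _ _ hs1 hd
      simp_all
  · intro hv
    split_ifs with hd h'
    · exact ⟨_, _, rfl, hs1, hd, hs2⟩
    · exact ⟨_, _, rfl, h'.choose_spec⟩
    · refine absurd (fun s s' ha hd' => ?_) hv
      by_contra hb
      exact h' ⟨(s, s'), ha, hd', by simpa using hb⟩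

/-- On the system with threshold `v`, the chain oracle answers a query as on the unsafe system
unless the states numbered `v` and `v + 1` are chosen to separate the query. -/
theorem exists_chainOracle_eq {k K : ℕ} (hK : K ≤ k) (α : PForm (Fin (2 * k + 3))) :
    ∃ i, ∀ v < 2 ^ K, v ≠ i →
      chainOracle k K (maxTr (thresholdForm hK v)) α = chainOracle k K PForm.tru α := by
  by_cases h : ∃ i, Separates K α i
  · refine ⟨h.choose, fun v hv hne => ?_⟩
    rw [chainOracle, chainOracle, dif_pos h, dif_pos h,
      if_pos ((eval_maxTr_chainState hK hv).2 hne.symm),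
      if_pos (show PForm.eval _ PForm.tru = true from rfl)]
  -- Without a separating index the answer is `none` for every system, and any exception will do.
  · exact ⟨0, fun v _ _ => by rw [chainOracle, chainOracle, dif_neg h, dif_neg h]⟩

/-! ### Indistinguishable runs and the exponential lower bound -/

theorem QueryRun.unique {Q R : Type} {step : List R → Q ⊕ Bool} {O : Q → R} {h : List R}
    {b b' : Bool} {m m' : ℕ} (r : QueryRun step O h b m) (r' : QueryRun step O h b' m') :
    b = b' ∧ m = m' := by
  induction r generalizing b' m' with
  | halt h b hs =>
    cases r' with
    | halt _ _ hs' => simp_all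
    | ask _ _ _ _ hs' => simp_all
  | ask h q b m hs hr ih =>
    cases r' with
    | halt _ _ hs' => simp_all
    | ask _ _ _ _ hs' hr' =>
      rw [hs] at hs'
      cases hs'
      have := ih hr'
      simp [this]

/-- If each query distinguishes at most one member of a family of oracles from `O`, then all but
`m` members lead to the same run of length `m`. -/
theorem QueryRun.exists_exceptions {Q R : Type} {step : List R → Q ⊕ Bool} {O : Q → R}
    {N : ℕ} {F : ℕ → Q → R} (hF : ∀ q, ∃ i, ∀ v < N, v ≠ i → F v q = O q)
    {h : List R} {b : Bool} {m : ℕ} (r : QueryRun step O h b m) :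
    ∃ E : Finset ℕ, E.card ≤ m ∧ ∀ v < N, v ∉ E → QueryRun step (F v) h b m := by
  classical
  induction r with
  | halt h b hs => exact ⟨∅, by simp, fun v _ _ => .halt h b hs⟩
  | ask h q b m hs hr ih =>
    obtain ⟨E, hE, hrun⟩ := ih
    obtain ⟨i, hi⟩ := hF q
    refine ⟨insert i E, (Finset.card_insert_le _ _).trans (by omega), fun v hv hvE => ?_⟩
    rw [Finset.mem_insert, not_or] at hvE
    refine .ask h q b m hs ?_
    rw [hi v hv hvE.1]
    exact hrun v hv hvE.2

/-- The run on the unsafe system must end in *no*. With fewer than `2 ^ K` queries, some threshold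
`v` is ruled out by none of them, so the same run occurs on its system, where the verdict has to be
*yes*. -/
theorem two_pow_le_queryComplexity {p : Polynomial ℚ} {A : QueryAlg inductivenessModel}
    (hA : DecidesInference A p MonMaxSys) {k K : ℕ} (hK : K ≤ k)
    (hp : ((K + 1 : ℕ) : ℚ) ≤ p.eval ((2 * k + 3 : ℕ) : ℚ)) :
    ((2 ^ K : ℕ) : ℕ∞) ≤ queryComplexity A MonMaxSys (2 * k + 3) := by
  have hQ := isInductivenessOracle_chainOracle k K
  -- The complexity is at least the count for the unsafe system with the chain oracle.
  refine le_trans ?_ (le_iSup₂_of_le (f := fun (T : TransSys (2 * k + 3)) (_ : MonMaxSys _ T) =>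
    ⨆ Q ∈ inductivenessModel.oracles _ T.Init T.Bad, queryCount A T Q) _ (.unsafeSys k)
    (le_iSup₂_of_le (chainOracle k K) hQ le_rfl))
  refine le_iInf₂ fun m hm => ?_
  obtain ⟨b, hrun⟩ := hm
  obtain ⟨b₀, m₀, hrun₀, hb₀⟩ := hA _ _ (.unsafeSys k) (chainOracle k K) hQ
  obtain ⟨rfl, rfl⟩ := hrun.unique hrun₀
  have hbf : b = false := by
    by_contra h
    exact not_hasShortInvariant_unsafe k p (hb₀.1 (by simpa using h))
  obtain ⟨E, hE, hEr⟩ := hrun.exists_exceptions (N := 2 ^ K)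
    (F := fun v => chainOracle k K (maxTr (thresholdForm hK v))) (exists_chainOracle_eq hK)
  by_contra hlt
  have hlt' : m < 2 ^ K := by exact_mod_cast not_le.1 hlt
  obtain ⟨v, hv, hvE⟩ := Finset.exists_mem_notMem_of_card_lt_card
    (s := E) (t := Finset.range (2 ^ K)) (by simpa using hE.trans_lt hlt')
  have hr := hEr v (Finset.mem_range.1 hv) hvE
  obtain ⟨b₁, m₁, hrun₁, hb₁⟩ := hA _ _ (monMaxSys_thresholdSys hK v) (chainOracle k K) hQ
  have := (hr.unique hrun₁).1
  rw [← this, hbf] at hb₁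
  exact Bool.false_ne_true (hb₁.2 (hasShortInvariant_thresholdSys hK v hp))

theorem inductiveness_lower_bound (p : Polynomial ℚ)
    (hp : ∃ c : ℚ, 0 < c ∧ ∀ᶠ n : ℕ in Filter.atTop, c * n ≤ p.eval (n : ℚ)) :
    ∃ c : ℝ, 0 < c ∧ ∃ k₀ : ℕ, ∀ A : QueryAlg inductivenessModel,
      DecidesInference A p MonMaxSys → ∀ k : ℕ, k₀ ≤ k →
        (2 : ENNReal) ^ (c * ((2 * k + 3 : ℕ) : ℝ)) ≤
          ((queryComplexity A MonMaxSys (2 * k + 3) : ℕ∞) : ENNReal) := by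
  obtain ⟨c, hc, hev⟩ := hp
  obtain ⟨n₀, hn₀⟩ := Filter.eventually_atTop.1 hev
  -- The number of digits is `⌊d n⌋ - 1`. Here `d ≤ c` makes the threshold formula short enough for
  -- `p(n)`, and `d ≤ 1/4` makes the digits fit into the `k` variables `x`.
  set d : ℚ := min c (1 / 4) with hd
  have hd0 : 0 < d := lt_min hc (by norm_num)
  have hdc : d ≤ c := min_le_left _ _
  have hd4 : d ≤ 1 / 4 := min_le_right _ _
  refine ⟨((d / 2 : ℚ) : ℝ), by exact_mod_cast half_pos hd0, max n₀ ⌈4 / d⌉₊, fun A hA k hk => ?_⟩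
  set n : ℕ := 2 * k + 3 with hn
  have hkn : (k : ℚ) ≤ n := by exact_mod_cast (show k ≤ n by omega)
  -- From this point on `⌊d n⌋ - 1 ≥ d n - 2 ≥ (d / 2) n`, whence the exponent `d / 2`.
  have hk4 : 4 ≤ d * n := by
    have h1 : 4 / d ≤ k := (Nat.le_ceil _).trans (by exact_mod_cast (le_max_right _ _).trans hk)
    rw [div_le_iff₀ hd0] at h1
    nlinarith
  have hpn : d * n ≤ p.eval (n : ℚ) := by
    have := hn₀ n (by have := (le_max_left _ _).trans hk; omega)
    refine le_trans ?_ this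
    gcongr
  set f : ℕ := ⌊d * n⌋₊ with hf
  have hf1 : (f : ℚ) ≤ d * n := Nat.floor_le (by linarith)
  have hf2 : d * n < f + 1 := Nat.lt_floor_add_one _
  have hf0 : 1 ≤ f := by
    by_contra h
    have : f = 0 := by omega
    rw [this] at hf2
    norm_num at hf2
    linarith
  have hfk : f - 1 ≤ k := by
    have h1 : (f : ℚ) ≤ (1 / 4) * n := hf1.trans (by gcongr)
    have h2 : (4 * f : ℚ) ≤ n := by linarith
    have h3 : 4 * f ≤ n := by exact_mod_cast h2
    omega
  have key := two_pow_le_queryComplexity hA hfk (p := p) (by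
    rw [Nat.sub_add_cancel hf0]
    exact hf1.trans hpn)
  have hexp : ((d / 2 : ℚ) : ℝ) * (n : ℝ) ≤ ((f - 1 : ℕ) : ℝ) := by
    have : d / 2 * n ≤ ((f - 1 : ℕ) : ℚ) := by
      rw [Nat.cast_sub hf0]
      push_cast
      linarith
    exact_mod_cast this
  calc (2 : ENNReal) ^ (((d / 2 : ℚ) : ℝ) * (n : ℝ)) ≤ 2 ^ ((f - 1 : ℕ) : ℝ) :=
        ENNReal.rpow_le_rpow_of_exponent_le (by norm_num) hexp
    _ = (((2 ^ (f - 1) : ℕ) : ℕ∞) : ENNReal) := by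
        rw [ENNReal.rpow_natCast]
        simp
    _ ≤ _ := by exact_mod_cast key

/-! ### Results and query counts of Hoare computations -/

namespace HoareComp

variable {n : ℕ} {A B : Type}

/-- The result of a computation with the given oracle. -/
def result (O : PForm (Fin n) × PForm (Fin n) → Bool) : HoareComp n A → A
  | ret a => a
  | ask α β next => (next (O (α, β))).result O

/-- The number of queries of a computation with the given oracle. -/
def count (O : PForm (Fin n) × PForm (Fin n) → Bool) : HoareComp n A → ℕ
  | ret _ => 0
  | ask α β next => (next (O (α, β))).count O + 1

variable (O : PForm (Fin n) × PForm (Fin n) → Bool)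

theorem result_bind (c : HoareComp n A) (f : A → HoareComp n B) :
    (c.bind f).result O = (f (c.result O)).result O := by
  induction c with
  | ret a => rfl
  | ask α β next ih => exact ih _

theorem count_bind (c : HoareComp n A) (f : A → HoareComp n B) :
    (c.bind f).count O = c.count O + (f (c.result O)).count O := by
  induction c with
  | ret a => simp [bind, count, result]
  | ask α β next ih =>
    simp only [bind, count, result, ih]
    omega

theorem queryRun_toStrategy (c : HoareComp n Bool) :
    QueryRun c.toStrategy O [] (c.result O) (c.count O) := by
  -- A strategy rereads the whole history at each call. The induction therefore speaks of any step
  -- function that, after the prefix `h`, acts like the rest of the computation.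
  suffices H : ∀ (c : HoareComp n Bool) (step : List Bool → (PForm (Fin n) × PForm (Fin n)) ⊕ Bool)
      (h : List Bool), (∀ l, step (h ++ l) = c.toStrategy l) →
      QueryRun step O h (c.result O) (c.count O) from H c _ [] fun _ => rfl
  intro c
  induction c with
  | ret a => exact fun step h hl => .halt _ _ (by simpa [toStrategy, result] using hl [])
  | ask α β next ih =>
    intro step h hl
    refine .ask _ (α, β) _ _ (by simpa [toStrategy] using hl []) (ih _ _ _ fun l => ?_)
    simpa [toStrategy] using hl (O (α, β) :: l)

end HoareComp

/-! ### Finding a counterexample variable by variable -/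

section Inference

open HoareComp

theorem hoareOracle_eq_true {n : ℕ} {δ : PForm (Fin n ⊕ Fin n)} {α β : PForm (Fin n)} :
    hoareOracle δ (α, β) = true ↔ HoareValid δ α β := by
  simp [hoareOracle]

theorem hoareOracle_eq_false {n : ℕ} {δ : PForm (Fin n ⊕ Fin n)} {α β : PForm (Fin n)} :
    hoareOracle δ (α, β) = false ↔ ∃ s s' : Fin n → Bool, α.eval s = true ∧
      δ.eval (Sum.elim s s') = true ∧ β.eval s' = false := by
  rw [← Bool.not_eq_true, hoareOracle_eq_true]
  simp [HoareValid]

theorem count_ctiLoop {n : ℕ} (O : PForm (Fin n) × PForm (Fin n) → Bool)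
    (l : List (Fin n ⊕ Fin n)) (α β : PForm (Fin n)) (v : Fin n ⊕ Fin n → Bool) :
    (ctiLoop l α β v).count O = l.length := by
  induction l generalizing α β v with
  | nil => rfl
  | cons z l ih =>
    rcases z with x | x <;> simp only [ctiLoop, count, List.length_cons] <;> split_ifs <;> rw [ih]

-- The loop keeps the current triple violated: if no violating transition gives the variable the
-- value *true*, every one gives it *false*. At the end any violating transition of the refined
-- triple agrees with the recorded values.
open Classical in
theorem result_ctiLoop {n : ℕ} {δ : PForm (Fin n ⊕ Fin n)} (l : List (Fin n ⊕ Fin n))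
    {α β : PForm (Fin n)} (v : Fin n ⊕ Fin n → Bool) (h : hoareOracle δ (α, β) = false) :
    ∃ s s' : Fin n → Bool, α.eval s = true ∧ δ.eval (Sum.elim s s') = true ∧ β.eval s' = false ∧
      ∀ z, (ctiLoop l α β v).result (hoareOracle δ) z =
        if z ∈ l then Sum.elim s s' z else v z := by
  induction l generalizing α β v with
  | nil =>
    obtain ⟨s, s', h1, h2, h3⟩ := hoareOracle_eq_false.1 h
    exact ⟨s, s', h1, h2, h3, fun z => by simp [ctiLoop, result]⟩
  | cons z l ih =>
    have upd {s s' : Fin n → Bool} {z : Fin n ⊕ Fin n} {b : Bool} (hb : Sum.elim s s' z = b)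
        (w : Fin n ⊕ Fin n) : (if w ∈ l then Sum.elim s s' w else Function.update v z b w) =
          if w ∈ z :: l then Sum.elim s s' w else v w := by
      by_cases hw : w ∈ l
      · simp [hw]
      · by_cases hz : w = z
        · subst hz; simp [hw, hb]
        · simp [hw, hz]
    rcases z with x | x
    · simp only [ctiLoop, result]
      split_ifs with hr
      · obtain ⟨s, s', h1, h2, h3, h4⟩ := ih (Function.update v (Sum.inl x) true) hr
        have h1' : α.eval s = true ∧ s x = true := by simpa [PForm.eval] using h1
        exact ⟨s, s', h1'.1, h2, h3, fun w => by rw [h4, upd (by simpa using h1'.2)]⟩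
      · have hr' : hoareOracle δ (α.and (PForm.var x).neg, β) = false := by
          obtain ⟨s, s', h1, h2, h3⟩ := hoareOracle_eq_false.1 h
          refine hoareOracle_eq_false.2 ⟨s, s', ?_, h2, h3⟩
          have hv := hoareOracle_eq_true.1 (Bool.eq_true_of_not_eq_false hr) s s'
          simp only [PForm.eval, Bool.and_eq_true] at hv ⊢
          cases hx : s x <;> simp_all
        obtain ⟨s, s', h1, h2, h3, h4⟩ := ih (Function.update v (Sum.inl x) false) hr'
        have h1' : α.eval s = true ∧ s x = false := by simpa [PForm.eval] using h1
        exact ⟨s, s', h1'.1, h2, h3, fun w => by rw [h4, upd (by simpa using h1'.2)]⟩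
    · simp only [ctiLoop, result]
      split_ifs with hr
      · obtain ⟨s, s', h1, h2, h3, h4⟩ := ih (Function.update v (Sum.inr x) true) hr
        have h3' : β.eval s' = false ∧ s' x = true := by simpa [PForm.eval] using h3
        exact ⟨s, s', h1, h2, h3'.1, fun w => by rw [h4, upd (by simpa using h3'.2)]⟩
      · have hr' : hoareOracle δ (α, β.or (PForm.var x)) = false := by
          obtain ⟨s, s', h1, h2, h3⟩ := hoareOracle_eq_false.1 h
          refine hoareOracle_eq_false.2 ⟨s, s', h1, h2, ?_⟩
          have hv := hoareOracle_eq_true.1 (Bool.eq_true_of_not_eq_false hr) s s' h1 h2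
          simp only [PForm.eval, Bool.or_eq_true, Bool.or_eq_false_iff] at hv ⊢
          cases hx : s' x <;> simp_all
        obtain ⟨s, s', h1, h2, h3, h4⟩ := ih (Function.update v (Sum.inr x) false) hr'
        have h3' : β.eval s' = false ∧ s' x = false := by simpa [PForm.eval] using h3
        exact ⟨s, s', h1, h2, h3'.1, fun w => by rw [h4, upd (by simpa using h3'.2)]⟩

theorem result_findCTI {n : ℕ} {δ : PForm (Fin n ⊕ Fin n)} {α β : PForm (Fin n)}
    (h : hoareOracle δ (α, β) = false) :
    α.eval ((findCTI α β).result (hoareOracle δ)).1 = true ∧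
      δ.eval (Sum.elim ((findCTI α β).result (hoareOracle δ)).1
        ((findCTI α β).result (hoareOracle δ)).2) = true ∧
      β.eval ((findCTI α β).result (hoareOracle δ)).2 = false := by
  obtain ⟨s, s', h1, h2, h3, h4⟩ := result_ctiLoop
    ((List.finRange n).map Sum.inl ++ (List.finRange n).map Sum.inr) (fun _ => false) h
  have : (findCTI α β).result (hoareOracle δ) = (s, s') := by
    rw [findCTI, result_bind]
    simp [result, h4]
  rw [this]
  exact ⟨h1, h2, h3⟩

theorem count_findCTI {n : ℕ} (O : PForm (Fin n) × PForm (Fin n) → Bool) (α β : PForm (Fin n)) :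
    (findCTI α β).count O = 2 * n := by
  rw [findCTI, count_bind, count_ctiLoop]
  simp [count]
  omega

/-! ### Generalization of a blocked cube -/

theorem count_blockLoop {n : ℕ} (O : PForm (Fin n) × PForm (Fin n) → Bool) (init : PForm (Fin n))
    (ls d : List (Fin n × Bool)) : (blockLoop init ls d).count O ≤ ls.length := by
  induction ls generalizing d with
  | nil => exact le_rfl
  | cons l ls ih =>
    simp only [blockLoop, List.length_cons]
    split_ifs
    · simp only [count]
      split_ifs
      · exact Nat.succ_le_succ (ih _)
      · exact Nat.succ_le_succ (ih _)
    · exact (ih _).trans (Nat.le_succ _)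

theorem eval_cubeForm {n : ℕ} (d : List (Fin n × Bool)) (s : Fin n → Bool) :
    (cubeForm d).eval s = true ↔ ∀ l ∈ d, s l.1 = l.2 := by
  simp only [cubeForm, PForm.eval_conj, List.forall_mem_map, PForm.eval_lit]

/-- The query from `Init` tests whether `φ` excludes the shortened cube. A literal that cannot be
dropped stays necessary, because later deletions only enlarge the set of states in the cube. Hence
one pass gives an irredundant cube. -/
theorem result_blockLoop {n : ℕ} {φ init : PForm (Fin n)} (hi : init.Entails φ)
    (hinit : ∃ s, init.eval s = true) (ls : List (Fin n × Bool)) {d : List (Fin n × Bool)}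
    (hd : d.Nodup) (hφ : φ.Entails (cubeForm d).neg) :
    ∃ d', (blockLoop init ls d).result (hoareOracle (maxTr φ)) = d' ∧ d'.Sublist d ∧
      φ.Entails (cubeForm d').neg ∧
      ∀ l ∈ ls, l ∈ d' → ¬ φ.Entails (cubeForm (d'.erase l)).neg := by
  induction ls generalizing d with
  | nil => exact ⟨d, rfl, List.Sublist.refl _, hφ, by simp⟩
  | cons l ls ih =>
    by_cases hl : φ.Entails (cubeForm (d.erase l)).neg
    · have hstep : (blockLoop init (l :: ls) d).result (hoareOracle (maxTr φ)) =
          (blockLoop init ls (d.erase l)).result (hoareOracle (maxTr φ)) := by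
        rw [blockLoop, if_pos (show init.Entails _ from fun s hs => hl s (hi s hs)), result,
          hoareOracle_eq_true.2 ((hoareValid_maxTr_init hi hinit _).2 hl), if_pos rfl]
      obtain ⟨d', h1, h2, h3, h4⟩ := ih (hd.erase l) hl
      refine ⟨d', hstep.trans h1, h2.trans List.erase_sublist, h3, fun l' hl' hld => ?_⟩
      rcases List.mem_cons.1 hl' with rfl | hl'
      · exact absurd (h2.subset hld) hd.not_mem_erase
      · exact h4 l' hl' hld
    · have hstep : (blockLoop init (l :: ls) d).result (hoareOracle (maxTr φ)) =
          (blockLoop init ls d).result (hoareOracle (maxTr φ)) := by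
        rw [blockLoop]
        split_ifs
        · rw [result, if_neg]
          rw [hoareOracle_eq_true, hoareValid_maxTr_init hi hinit]
          exact hl
        · rfl
      obtain ⟨d', h1, h2, h3, h4⟩ := ih hd hφ
      refine ⟨d', hstep.trans h1, h2, h3, fun l' hl' hld => ?_⟩
      rcases List.mem_cons.1 hl' with rfl | hl'
      · refine fun h => hl fun s hs => ?_
        have := h s hs
        simp only [PForm.eval, Bool.not_eq_true', ← Bool.not_eq_true, eval_cubeForm] at this ⊢
        exact fun hall => this fun m hm => hall m ((h2.erase l').subset hm)
      · exact h4 l' hl' hld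

theorem mem_cubeOf {n : ℕ} {σ : Fin n → Bool} {l : Fin n × Bool} : l ∈ cubeOf σ ↔ σ l.1 = l.2 := by
  rcases l with ⟨x, b⟩
  simp [cubeOf]

theorem nodup_cubeOf {n : ℕ} (σ : Fin n → Bool) : (cubeOf σ).Nodup :=
  (List.nodup_finRange n).map fun _ _ h => (Prod.ext_iff.1 h).1

/-- Generalizing a non-model below itself gives the cube of the states above a minimal
non-model. -/
theorem result_blockLoop_cubeOf {n : ℕ} {φ init : PForm (Fin n)} (hanti : φ.IsAntitone)
    (hi : init.Entails φ) (hinit : ∃ s, init.eval s = true) {σ : Fin n → Bool}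
    (hσ : φ.eval σ = false) :
    ∃ τ, φ.MinFalse τ ∧ τ ≤ σ ∧ ∀ s, (cubeForm ((blockLoop init (cubeOf σ) (cubeOf σ)).result
      (hoareOracle (maxTr φ)))).eval s = true ↔ τ ≤ s := by
  have hσφ : φ.Entails (cubeForm (cubeOf σ)).neg := by
    intro s hs
    simp only [PForm.eval, Bool.not_eq_true', ← Bool.not_eq_true, eval_cubeForm]
    intro hall
    have : s = σ := funext fun x => hall (x, σ x) (mem_cubeOf.2 rfl)
    simp_all
  obtain ⟨d, hres, hsub, hblock, hmin⟩ :=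
    result_blockLoop hi hinit (cubeOf σ) (nodup_cubeOf σ) hσφ
  rw [hres]
  have hdσ : ∀ l ∈ d, σ l.1 = l.2 := fun l hl => mem_cubeOf.1 (hsub.subset hl)
  have hnd : d.Nodup := hsub.nodup (nodup_cubeOf σ)
  have hmin' : ∀ l ∈ d, ∃ s, φ.eval s = true ∧ ∀ m ∈ d, m ≠ l → s m.1 = m.2 := by
    intro l hl
    have := hmin l (mem_cubeOf.2 (hdσ l hl)) hl
    simp only [PForm.Entails, PForm.eval, Bool.not_eq_true', ← Bool.not_eq_true, eval_cubeForm] at this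
    push Not at this
    obtain ⟨s, hs, h⟩ := this
    exact ⟨s, hs, fun m hm hne => h m ((hnd.mem_erase_iff).2 ⟨hne, hm⟩)⟩
  -- An irredundant cube has no negative literal: a model of `φ` in the cube without `¬x` remains a
  -- model when `x` is switched off, and then lies in the full cube.
  have hpos : ∀ l ∈ d, l.2 = true := by
    rintro ⟨x, b⟩ hl
    by_contra hb
    have hb : b = false := by simpa using hb
    subst hb
    obtain ⟨s, hs, hm⟩ := hmin' _ hl
    have hle : Function.update s x false ≤ s := by
      intro y
      by_cases hy : y = x
      · subst hy; simp
      · simp [hy]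
    have := hblock _ (hanti _ _ hle hs)
    simp only [PForm.eval, Bool.not_eq_true', ← Bool.not_eq_true, eval_cubeForm] at this
    refine this fun m hmd => ?_
    by_cases hx : m.1 = x
    · have h1 := hdσ m hmd
      have h2 := hdσ _ hl
      simp_all
    · rw [Function.update_of_ne hx]
      exact hm m hmd fun h => hx (by rw [h])
  have hcube : ∀ s : Fin n → Bool,
      (cubeForm d).eval s = true ↔ (fun x => decide ((x, true) ∈ d)) ≤ s := by
    intro s
    rw [eval_cubeForm]
    constructor
    · intro h x
      by_cases hx : (x, true) ∈ d
      · simp [hx, h _ hx]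
      · simp [hx]
    · rintro h ⟨x, b⟩ hl
      have hb : b = true := hpos _ hl
      subst hb
      have := h x
      simp only [hl, decide_true] at this
      exact top_le_iff.1 this
  refine ⟨_, ⟨?_, fun x hx => ?_⟩, fun x => ?_, hcube⟩
  · by_contra h
    have := hblock _ (by simpa using h)
    simp only [PForm.eval, Bool.not_eq_true', ← Bool.not_eq_true, hcube] at this
    exact this le_rfl
  -- Irredundancy gives a model of `φ` satisfying all the other literals, and it lies above the
  -- state with `x` switched off.
  · obtain ⟨s, hs, hm⟩ := hmin' _ (of_decide_eq_true hx)
    refine hanti _ s (fun y => ?_) hs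
    by_cases hy : y = x
    · subst hy; simp
    · by_cases hyd : (y, true) ∈ d
      · simp [hy, hm _ hyd (by simpa using hy)]
      · simp [hy, hyd]
  · by_cases hx : (x, true) ∈ d
    · simp [hx, hdσ _ hx]
    · simp [hx]

/-! ### Correctness and query complexity of PDR-1 -/

theorem hoareOracle_maxTr_self {n : ℕ} {φ init bad I : PForm (Fin n)} (hi : init.Entails φ)
    (hb : φ.Entails bad.neg) (hinit : ∃ s, init.eval s = true) (hbad : ∃ s, bad.eval s = true)
    (hφI : φ.Entails I) (hI : I.Entails bad.neg) (h : hoareOracle (maxTr φ) (I, I) = true) :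
    ∀ s, I.eval s = φ.eval s :=
  (isInvariant_maxTr_iff hi hb hinit hbad I).1
    ⟨fun s hs => hφI s (hi s hs), hoareOracle_eq_true.1 h, hI⟩

/-- A strengthening of PDR-1 removes the states above a new minimal non-model. -/
theorem exists_minFalse_strengthening {n : ℕ} {φ init I : PForm (Fin n)} (hanti : φ.IsAntitone)
    (hi : init.Entails φ) (hinit : ∃ s, init.eval s = true) (hφI : φ.Entails I)
    (h : hoareOracle (maxTr φ) (I, I) = false) :
    ∃ τ σ, φ.MinFalse τ ∧ τ ≤ σ ∧ I.eval σ = true ∧ ∀ s, (cubeForm ((blockLoop init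
      (cubeOf ((findCTI I I).result (hoareOracle (maxTr φ))).1)
      (cubeOf ((findCTI I I).result (hoareOracle (maxTr φ))).1)).result
        (hoareOracle (maxTr φ)))).eval s = true ↔ τ ≤ s := by
  obtain ⟨h1, h2, h3⟩ := result_findCTI h
  -- The post-state violates `I`, hence `φ`, and models of `φ` have no such successor.
  have hσ : φ.eval ((findCTI I I).result (hoareOracle (maxTr φ))).1 = false := by
    by_contra hσ
    have := hφI _ ((eval_maxTr _ _ _).1 h2 (by simpa using hσ))
    simp_all
  obtain ⟨τ, hτ, hle, hcube⟩ := result_blockLoop_cubeOf hanti hi hinit hσ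
  exact ⟨τ, _, hτ, hle, h1, hcube⟩

/-- With as many strengthenings as there are clauses in some equivalent formula, PDR-1 finds a
formula equivalent to `φ`. -/
theorem result_pdr1Loop {n : ℕ} {φ init bad : PForm (Fin n)} (hanti : φ.IsAntitone)
    (hi : init.Entails φ) (hb : φ.Entails bad.neg) (hinit : ∃ s, init.eval s = true)
    (hbad : ∃ s, bad.eval s = true) {cs : List (List (Fin n × Bool))}
    (hcs : ∀ s, (PForm.ofClauses cs).eval s = φ.eval s) (fuel : ℕ) (L : List (Fin n → Bool))
    (hL : L.Nodup) (hmin : ∀ τ ∈ L, φ.MinFalse τ) (I : PForm (Fin n))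
    (hI : ∀ s, I.eval s = true ↔ bad.neg.eval s = true ∧ ∀ τ ∈ L, ¬ τ ≤ s)
    (hfuel : cs.length ≤ fuel + L.length) :
    ∃ J, (pdr1Loop init fuel I).result (hoareOracle (maxTr φ)) = some J ∧
      ∀ s, J.eval s = φ.eval s := by
  induction fuel generalizing L I with
  | zero =>
    have hφI : φ.Entails I := fun s hs => (hI s).2 ⟨hb s hs, fun τ hτ hle => by
      have := hanti.eq_false_of_le hle (hmin τ hτ).1
      simp_all⟩
    have hq : hoareOracle (maxTr φ) (I, I) = true := by
      by_contra h
      obtain ⟨τ, σ, h1, h2, h3, -⟩ :=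
        exists_minFalse_strengthening hanti hi hinit hφI (by simpa using h)
      -- The minimal non-model is new, because `σ` above it still satisfies `I`. With it there would
      -- be more minimal non-models than clauses.
      have := PForm.length_le_of_minFalse hanti cs hcs (τ :: L)
        (List.nodup_cons.2 ⟨fun hmem => ((hI σ).1 h3).2 τ hmem h2, hL⟩) (by simpa using ⟨h1, hmin⟩)
      simp only [List.length_cons] at this
      omega
    exact ⟨I, by simp [pdr1Loop, result, hq],
      hoareOracle_maxTr_self hi hb hinit hbad hφI (fun s hs => ((hI s).1 hs).1) hq⟩
  | succ fuel ih =>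
    have hφI : φ.Entails I := fun s hs => (hI s).2 ⟨hb s hs, fun τ hτ hle => by
      have := hanti.eq_false_of_le hle (hmin τ hτ).1
      simp_all⟩
    by_cases hq : hoareOracle (maxTr φ) (I, I) = true
    · exact ⟨I, by simp [pdr1Loop, result, hq],
        hoareOracle_maxTr_self hi hb hinit hbad hφI (fun s hs => ((hI s).1 hs).1) hq⟩
    · obtain ⟨τ, σ, h1, h2, h3, h4⟩ :=
        exists_minFalse_strengthening hanti hi hinit hφI (by simpa using hq)
      rw [pdr1Loop, result, if_neg hq, result_bind, result_bind]
      refine ih (τ :: L) (List.nodup_cons.2 ⟨fun hmem => ((hI σ).1 h3).2 τ hmem h2, hL⟩)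
        (by simpa using ⟨h1, hmin⟩) _ (fun s => ?_) (by simp only [List.length_cons]; omega)
      simp only [PForm.eval, Bool.and_eq_true, hI, Bool.not_eq_true', ← Bool.not_eq_true,
        h4, List.forall_mem_cons]
      tauto

theorem count_pdr1Loop {n : ℕ} (O : PForm (Fin n) × PForm (Fin n) → Bool) (init : PForm (Fin n))
    (fuel : ℕ) (I : PForm (Fin n)) :
    (pdr1Loop init fuel I).count O ≤ fuel * (3 * n + 1) + 1 := by
  induction fuel generalizing I with
  | zero => simp [pdr1Loop, count]
  | succ fuel ih =>
    rw [pdr1Loop, count]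
    split_ifs
    · simp [count]
    · rw [count_bind, count_bind, count_findCTI]
      have h1 := count_blockLoop O init (cubeOf ((findCTI I I).result O).1)
        (cubeOf ((findCTI I I).result O).1)
      have h2 := ih (I.and (cubeForm ((blockLoop init (cubeOf ((findCTI I I).result O).1)
        (cubeOf ((findCTI I I).result O).1)).result O)).neg)
      have h3 : (cubeOf ((findCTI I I).result O).1).length = n := by simp [cubeOf]
      rw [Nat.add_mul]
      omega

theorem result_pdr1 {n : ℕ} {φ init bad : PForm (Fin n)} (hanti : φ.IsAntitone)
    (hi : init.Entails φ) (hb : φ.Entails bad.neg) (hinit : ∃ s, init.eval s = true)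
    (hbad : ∃ s, bad.eval s = true) {cs : List (List (Fin n × Bool))}
    (hcs : ∀ s, (PForm.ofClauses cs).eval s = φ.eval s) {fuel : ℕ} (hfuel : cs.length ≤ fuel) :
    ∃ J, (pdr1 init bad fuel).result (hoareOracle (maxTr φ)) = some J ∧
      ∀ s, J.eval s = φ.eval s :=
  result_pdr1Loop hanti hi hb hinit hbad hcs fuel [] List.nodup_nil (by simp) _ (by simp) (by simpa)

/-- The computation carried out by `pdr1Decide`. -/
noncomputable def pdr1Comp (p : Polynomial ℚ) {n : ℕ} (init bad : PForm (Fin n)) :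
    HoareComp n Bool :=
  (pdr1 init bad ⌊p.eval (n : ℚ)⌋₊).bind fun res =>
    match res with
    | none => .ret false
    | some I => .ask I I fun r =>
        open Classical in
        .ret (r && decide ((∃ J : PForm (Fin n), J.IsCNF (p.eval (n : ℚ)) ∧
          ∀ s, J.eval s = I.eval s) ∧ init.Entails I ∧ I.Entails bad.neg))

theorem count_pdr1Comp (p : Polynomial ℚ) {n : ℕ} (init bad : PForm (Fin n))
    (O : PForm (Fin n) × PForm (Fin n) → Bool) :
    (pdr1Comp p init bad).count O ≤ ⌊p.eval (n : ℚ)⌋₊ * (3 * n + 1) + 2 := by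
  rw [pdr1Comp, count_bind]
  have h := count_pdr1Loop O init ⌊p.eval (n : ℚ)⌋₊ bad.neg
  rw [← pdr1] at h
  cases (pdr1 init bad ⌊p.eval (n : ℚ)⌋₊).result O
  · simp only [count]
    omega
  · simp only [count]
    omega

theorem result_pdr1Comp {p : Polynomial ℚ} {n : ℕ} {init bad : PForm (Fin n)}
    {O : PForm (Fin n) × PForm (Fin n) → Bool} :
    (pdr1Comp p init bad).result O = true ↔
      ∃ I, (pdr1 init bad ⌊p.eval (n : ℚ)⌋₊).result O = some I ∧ O (I, I) = true ∧
        (∃ J : PForm (Fin n), J.IsCNF (p.eval (n : ℚ)) ∧ ∀ s, J.eval s = I.eval s) ∧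
        init.Entails I ∧ I.Entails bad.neg := by
  rw [pdr1Comp, result_bind]
  cases (pdr1 init bad ⌊p.eval (n : ℚ)⌋₊).result O <;> simp [result]

theorem hasShortInvariant_of_pdr1Comp {p : Polynomial ℚ} {n : ℕ} {T : TransSys n}
    (h : (pdr1Comp p T.Init T.Bad).result (hoareOracle T.delta) = true) :
    T.HasShortInvariant p := by
  obtain ⟨I, -, hind, ⟨J, hJ, hJI⟩, hi, hb⟩ := result_pdr1Comp.1 h
  refine ⟨J, hJ, fun s hs => ?_, (hoareValid_congr hJI).2 (hoareOracle_eq_true.1 hind), fun s hs => ?_⟩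
  · rw [hJI]
    exact hi s hs
  · rw [hJI] at hs
    exact hb s hs

/-- A *yes* is sound on every system, as the returned formula is checked. Conversely, a short
invariant of a maximal system is a CNF of `φ` with at most `⌊p(n)⌋` clauses, so the strengthenings
suffice. -/
theorem decidesInference_pdr1Decide (p : Polynomial ℚ) :
    DecidesInference (pdr1Decide p) p MonMaxSys := by
  rintro n T hT Q rfl
  refine ⟨_, _, queryRun_toStrategy (hoareOracle T.delta) (pdr1Comp p T.Init T.Bad),
    hasShortInvariant_of_pdr1Comp, fun hshort => ?_⟩
  cases hT with
  | unsafeSys k => exact absurd hshort (not_hasShortInvariant_unsafe k p)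
  | maximal k φ hmon hi hb =>
    obtain ⟨I, ⟨cs, hlen, rfl⟩, hinv⟩ := hshort
    have hcs := (isInvariant_maxTr_iff hi hb (exists_eval_initK k) (exists_eval_badK k) _).1 hinv
    obtain ⟨J, hres, hJ⟩ := result_pdr1 hmon.isAntitone hi hb (exists_eval_initK k)
      (exists_eval_badK k) hcs (Nat.le_floor hlen)
    have hJinv := (isInvariant_maxTr_iff hi hb (exists_eval_initK k) (exists_eval_badK k) J).2 hJ
    exact result_pdr1Comp.2 ⟨J, hres, hoareOracle_eq_true.2 hJinv.2.1,
      ⟨_, ⟨cs, hlen, rfl⟩, fun s => by rw [hcs, hJ]⟩, hJinv.1, hJinv.2.2⟩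

theorem exists_queryComplexity_pdr1Decide_le (p : Polynomial ℚ) :
    ∃ r : Polynomial ℕ, ∀ n : ℕ,
      queryComplexity (pdr1Decide p) MonMaxSys n ≤ ((r.eval n : ℕ) : ℕ∞) := by
  obtain ⟨D, P, N, hD, h⟩ := p.exists_nat_sub
  refine ⟨P * (3 * Polynomial.X + 1) + 2, fun n => ?_⟩
  refine iSup₂_le fun T _ => iSup₂_le fun Q hQ => ?_
  obtain rfl : Q = hoareOracle := hQ
  refine (iInf₂_le (f := fun (m : ℕ) _ => (m : ℕ∞)) _
    ⟨_, queryRun_toStrategy (hoareOracle T.delta) (pdr1Comp p T.Init T.Bad)⟩).trans ?_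
  -- Since `D ≥ 1` and the subtracted polynomial is nonnegative, `p(n)` is at most `P(n)`.
  have hfloor : ⌊p.eval (n : ℚ)⌋₊ ≤ P.eval n := by
    refine Nat.floor_le_of_le ?_
    have h1 := h n
    have h2 : (1 : ℚ) ≤ D := by exact_mod_cast hD
    have h3 : (0 : ℚ) ≤ (N.eval n : ℕ) := Nat.cast_nonneg _
    have h4 : (0 : ℚ) ≤ (P.eval n : ℕ) := Nat.cast_nonneg _
    by_contra hlt
    nlinarith [not_le.1 hlt]
  have hcount := count_pdr1Comp p T.Init T.Bad (hoareOracle T.delta)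
  have : (pdr1Comp p T.Init T.Bad).count (hoareOracle T.delta) ≤
      (P * (3 * Polynomial.X + 1) + 2 : Polynomial ℕ).eval n := by
    refine hcount.trans ?_
    simp only [Polynomial.eval_add, Polynomial.eval_mul, Polynomial.eval_X, Polynomial.eval_ofNat,
      Polynomial.eval_one]
    gcongr
  exact_mod_cast this

end Inference

/-! ### Step-bounded runs on stores with ten registers -/

/-- Contents of the registers `0, …, 9` of a store whose other registers are empty. -/
structure Regs where
  (r0 r1 r2 r3 r4 r5 r6 r7 r8 r9 : List Tok)

namespace Regs

def get (R : Regs) : ℕ → List Tok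
  | 0 => R.r0
  | 1 => R.r1
  | 2 => R.r2
  | 3 => R.r3
  | 4 => R.r4
  | 5 => R.r5
  | 6 => R.r6
  | 7 => R.r7
  | 8 => R.r8
  | 9 => R.r9
  | _ => []

def set (R : Regs) (i : ℕ) (l : List Tok) : Regs :=
  match i with
  | 0 => { R with r0 := l }
  | 1 => { R with r1 := l }
  | 2 => { R with r2 := l }
  | 3 => { R with r3 := l }
  | 4 => { R with r4 := l }
  | 5 => { R with r5 := l }
  | 6 => { R with r6 := l }
  | 7 => { R with r7 := l }
  | 8 => { R with r8 := l }
  | 9 => { R with r9 := l }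
  | _ => R

theorem get_set (R : Regs) {i : ℕ} (hi : i < 10) (l : List Tok) :
    (R.set i l).get = Function.update R.get i l := by
  funext j
  by_cases hj : j = i
  · subst hj
    rw [Function.update_self]
    interval_cases j <;> rfl
  · rw [Function.update_of_ne hj]
    by_cases hj' : j < 10
    · interval_cases i <;> interval_cases j <;> first | rfl | exact absurd rfl hj
    · obtain ⟨m, rfl⟩ := Nat.exists_eq_add_of_le (not_lt.1 hj')
      rw [Nat.add_comm]
      rfl

variable (a0 a1 a2 a3 a4 a5 a6 a7 a8 a9 l : List Tok)

theorem get_mk : letI R := Regs.mk a0 a1 a2 a3 a4 a5 a6 a7 a8 a9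
    R.get 0 = a0 ∧ R.get 1 = a1 ∧ R.get 2 = a2 ∧ R.get 3 = a3 ∧ R.get 4 = a4 ∧ R.get 5 = a5 ∧
      R.get 6 = a6 ∧ R.get 7 = a7 ∧ R.get 8 = a8 ∧ R.get 9 = a9 :=
  ⟨rfl, rfl, rfl, rfl, rfl, rfl, rfl, rfl, rfl, rfl⟩

theorem set_mk : letI R := Regs.mk a0 a1 a2 a3 a4 a5 a6 a7 a8 a9
    R.set 0 l = ⟨l, a1, a2, a3, a4, a5, a6, a7, a8, a9⟩ ∧
      R.set 1 l = ⟨a0, l, a2, a3, a4, a5, a6, a7, a8, a9⟩ ∧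
      R.set 2 l = ⟨a0, a1, l, a3, a4, a5, a6, a7, a8, a9⟩ ∧
      R.set 3 l = ⟨a0, a1, a2, l, a4, a5, a6, a7, a8, a9⟩ ∧
      R.set 4 l = ⟨a0, a1, a2, a3, l, a5, a6, a7, a8, a9⟩ ∧
      R.set 5 l = ⟨a0, a1, a2, a3, a4, l, a6, a7, a8, a9⟩ ∧
      R.set 6 l = ⟨a0, a1, a2, a3, a4, a5, l, a7, a8, a9⟩ ∧
      R.set 7 l = ⟨a0, a1, a2, a3, a4, a5, a6, l, a8, a9⟩ ∧
      R.set 8 l = ⟨a0, a1, a2, a3, a4, a5, a6, a7, l, a9⟩ ∧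
      R.set 9 l = ⟨a0, a1, a2, a3, a4, a5, a6, a7, a8, l⟩ :=
  ⟨rfl, rfl, rfl, rfl, rfl, rfl, rfl, rfl, rfl, rfl⟩

end Regs

/-- `P` leads from `R` to `R'` in at most `B` steps. -/
def Runs (O : List Tok → List Tok → Bool) (P : Prog) (R R' : Regs) (B : ℕ) : Prop :=
  ∃ t ≤ B, Exec O P R.get R'.get t

/-- Sequential composition of a list of programs. -/
def Prog.seqs : List Prog → Prog
  | [] => .skip
  | P :: Ps => .seq P (seqs Ps)

namespace Runs

variable {O : List Tok → List Tok → Bool} {P Q : Prog} {R R' R'' : Regs} {B B' : ℕ}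

theorem mono (h : Runs O P R R' B) (hB : B ≤ B') : Runs O P R R' B' := by
  obtain ⟨t, ht, he⟩ := h
  exact ⟨t, ht.trans hB, he⟩

theorem congr (h : Runs O P R R' B) (hR : R' = R'') (hB : B ≤ B') : Runs O P R R'' B' :=
  hR ▸ h.mono hB

theorem nil : Runs O (.seqs []) R R 1 := ⟨1, le_rfl, .skip _⟩

theorem skip : Runs O .skip R R 1 := ⟨1, le_rfl, .skip _⟩

theorem seq (h : Runs O P R R' B) (h' : Runs O Q R' R'' B') : Runs O (.seq P Q) R R'' (B + B') := by
  obtain ⟨t, ht, he⟩ := h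
  obtain ⟨t', ht', he'⟩ := h'
  exact ⟨t + t', Nat.add_le_add ht ht', .seq _ _ _ _ _ _ _ he he'⟩

theorem cons {Ps : List Prog} (h : Runs O P R R' B) (h' : Runs O (.seqs Ps) R' R'' B') :
    Runs O (.seqs (P :: Ps)) R R'' (B + B') := h.seq h'

theorem push (r : ℕ) (a : Tok) (hr : r < 10 := by norm_num) :
    Runs O (.push r a) R (R.set r (a :: R.get r)) 1 :=
  ⟨1, le_rfl, by rw [Regs.get_set _ hr]; exact .push _ _ _⟩

theorem pop (r : ℕ) (hr : r < 10 := by norm_num) :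
    Runs O (.pop r) R (R.set r (R.get r).tail) 1 :=
  ⟨1, le_rfl, by rw [Regs.get_set _ hr]; exact .pop _ _⟩

theorem query (u v r : ℕ) (hr : r < 10 := by norm_num) :
    Runs O (.query u v r) R
      (R.set r ((if O (R.get u) (R.get v) = true then Tok.tt else Tok.ff) :: R.get r)) 1 :=
  ⟨1, le_rfl, by rw [Regs.get_set _ hr]; exact .query _ _ _ _⟩

theorem ite_pos {c : Test} (hc : c.Holds R.get) (h : Runs O P R R' B) :
    Runs O (.ite c P Q) R R' (B + 1) := by
  obtain ⟨t, ht, he⟩ := h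
  exact ⟨t + 1, Nat.add_le_add_right ht 1, .ite_pos _ _ _ _ _ _ hc he⟩

theorem ite_neg {c : Test} (hc : ¬ c.Holds R.get) (h : Runs O Q R R' B) :
    Runs O (.ite c P Q) R R' (B + 1) := by
  obtain ⟨t, ht, he⟩ := h
  exact ⟨t + 1, Nat.add_le_add_right ht 1, .ite_neg _ _ _ _ _ _ hc he⟩

theorem loop_exit {c : Test} (hc : ¬ c.Holds R.get) : Runs O (.loop c P) R R 1 :=
  ⟨1, le_rfl, Exec.loop_stop _ _ _ hc⟩

theorem loop_step {c : Test} (hc : c.Holds R.get) (h : Runs O P R R' B)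
    (h' : Runs O (.loop c P) R' R'' B') : Runs O (.loop c P) R R'' (B + B' + 1) := by
  obtain ⟨t, ht, he⟩ := h
  obtain ⟨t', ht', he'⟩ := h'
  exact ⟨t + t' + 1, by omega, .loop_step _ _ _ _ _ _ _ hc he he'⟩

/-- A loop whose body establishes the next of a sequence of invariants, at most `M` times. -/
theorem loop_of_invariant {c : Test} (Inv : ℕ → Regs → Prop) (M : ℕ)
    (hstep : ∀ i R, Inv i R → c.Holds R.get → i < M ∧ ∃ R', Runs O P R R' B ∧ Inv (i + 1) R')
    (h0 : Inv 0 R) :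
    ∃ i R', Runs O (.loop c P) R R' (M * (B + 1) + 1) ∧ Inv i R' ∧ ¬ c.Holds R'.get := by
  -- Induction on a bound `k` for the number of iterations that remain.
  suffices H : ∀ k i R, M - i ≤ k → Inv i R →
      ∃ i R', Runs O (.loop c P) R R' (k * (B + 1) + 1) ∧ Inv i R' ∧ ¬ c.Holds R'.get from
    H M 0 R (by omega) h0
  intro k
  induction k with
  | zero =>
    intro i R hi hR
    by_cases hc : c.Holds R.get
    · have := (hstep i R hR hc).1
      omega
    · exact ⟨i, R, (loop_exit hc).mono (by omega), hR, hc⟩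
  | succ k ih =>
    intro i R hi hR
    by_cases hc : c.Holds R.get
    · obtain ⟨hlt, R', hrun, hR'⟩ := hstep i R hR hc
      obtain ⟨j, R'', hrun', hR'', hc'⟩ := ih (i + 1) R' (by omega) hR'
      exact ⟨j, R'', (loop_step hc hrun hrun').mono (by rw [Nat.succ_mul]; omega), hR'', hc'⟩
    · exact ⟨i, R, (loop_exit hc).mono (by omega), hR, hc⟩

end Runs

/-- The number `m` in unary. -/
abbrev ones (m : ℕ) : List Tok := List.replicate m Tok.one

theorem ones_append_cons (m : ℕ) (l : List Tok) :
    ones m ++ Tok.one :: l = Tok.one :: (ones m ++ l) := by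
  induction m with
  | zero => rfl
  | succ m ih => simpa [ones, List.replicate_succ] using ih

variable {O : List Tok → List Tok → Bool}

theorem not_holds_nonempty {s : Store} {r : ℕ} (h : s r = []) : ¬ (Test.nonempty r).Holds s :=
  fun h' => h' h

theorem holds_nonempty {s : Store} {r : ℕ} {a : Tok} {l : List Tok} (h : s r = a :: l) :
    (Test.nonempty r).Holds s := by
  simp [Test.Holds, h]

/-! ### Evaluation of polynomials in unary -/

/-- Moves a number from register `r` to register `r'`. -/
def moveOnes (r r' : ℕ) : Prog := .loop (.nonempty r) (.seq (.pop r) (.push r' .one))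

/-- Each pair of registers in use has its own lemma: for concrete register numbers the updates of
the explicit tuple hold by `rfl`. -/
theorem runs_moveOnes_6_4 (m : ℕ) (a0 a1 a2 a3 a4 a5 a7 a8 a9 : List Tok) :
    Runs O (moveOnes 6 4) ⟨a0, a1, a2, a3, a4, a5, ones m, a7, a8, a9⟩
      ⟨a0, a1, a2, a3, ones m ++ a4, a5, [], a7, a8, a9⟩ (3 * m + 1) := by
  induction m generalizing a4 with
  | zero => exact Runs.loop_exit (not_holds_nonempty rfl)
  | succ m ih =>
    refine (Runs.loop_step (holds_nonempty rfl) ((Runs.pop 6).seq (Runs.push 4 .one))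
      (ih (Tok.one :: a4))).congr ?_ (by omega)
    rw [ones_append_cons]
    rfl

theorem runs_moveOnes_6_7 (m : ℕ) (a0 a1 a2 a3 a4 a5 a7 a8 a9 : List Tok) :
    Runs O (moveOnes 6 7) ⟨a0, a1, a2, a3, a4, a5, ones m, a7, a8, a9⟩
      ⟨a0, a1, a2, a3, a4, a5, [], ones m ++ a7, a8, a9⟩ (3 * m + 1) := by
  induction m generalizing a7 with
  | zero => exact Runs.loop_exit (not_holds_nonempty rfl)
  | succ m ih =>
    refine (Runs.loop_step (holds_nonempty rfl) ((Runs.pop 6).seq (Runs.push 7 .one))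
      (ih (Tok.one :: a7))).congr ?_ (by omega)
    rw [ones_append_cons]
    rfl

theorem runs_moveOnes_5_0 (m : ℕ) (a0 a1 a2 a3 a4 a6 a7 a8 a9 : List Tok) :
    Runs O (moveOnes 5 0) ⟨a0, a1, a2, a3, a4, ones m, a6, a7, a8, a9⟩
      ⟨ones m ++ a0, a1, a2, a3, a4, [], a6, a7, a8, a9⟩ (3 * m + 1) := by
  induction m generalizing a0 with
  | zero => exact Runs.loop_exit (not_holds_nonempty rfl)
  | succ m ih =>
    refine (Runs.loop_step (holds_nonempty rfl) ((Runs.pop 5).seq (Runs.push 0 .one))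
      (ih (Tok.one :: a0))).congr ?_ (by omega)
    rw [ones_append_cons]
    rfl

theorem runs_moveOnes_5_4 (m : ℕ) (a0 a1 a2 a3 a4 a6 a7 a8 a9 : List Tok) :
    Runs O (moveOnes 5 4) ⟨a0, a1, a2, a3, a4, ones m, a6, a7, a8, a9⟩
      ⟨a0, a1, a2, a3, ones m ++ a4, [], a6, a7, a8, a9⟩ (3 * m + 1) := by
  induction m generalizing a4 with
  | zero => exact Runs.loop_exit (not_holds_nonempty rfl)
  | succ m ih =>
    refine (Runs.loop_step (holds_nonempty rfl) ((Runs.pop 5).seq (Runs.push 4 .one))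
      (ih (Tok.one :: a4))).congr ?_ (by omega)
    rw [ones_append_cons]
    rfl

theorem runs_moveOnes_4_0 (m : ℕ) (a0 a1 a2 a3 a5 a6 a7 a8 a9 : List Tok) :
    Runs O (moveOnes 4 0) ⟨a0, a1, a2, a3, ones m, a5, a6, a7, a8, a9⟩
      ⟨ones m ++ a0, a1, a2, a3, [], a5, a6, a7, a8, a9⟩ (3 * m + 1) := by
  induction m generalizing a0 with
  | zero => exact Runs.loop_exit (not_holds_nonempty rfl)
  | succ m ih =>
    refine (Runs.loop_step (holds_nonempty rfl) ((Runs.pop 4).seq (Runs.push 0 .one))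
      (ih (Tok.one :: a0))).congr ?_ (by omega)
    rw [ones_append_cons]
    rfl

/-- Adds register 0 to register 6, and moves it to register 5. -/
def addLoop : Prog :=
  .loop (.nonempty 0) (.seq (.pop 0) (.seq (.push 5 .one) (.push 6 .one)))

theorem runs_addLoop (m : ℕ) (a1 a2 a3 a4 a5 a6 a7 a8 a9 : List Tok) :
    Runs O addLoop ⟨ones m, a1, a2, a3, a4, a5, a6, a7, a8, a9⟩
      ⟨[], a1, a2, a3, a4, ones m ++ a5, ones m ++ a6, a7, a8, a9⟩ (4 * m + 1) := by
  induction m generalizing a5 a6 with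
  | zero => exact Runs.loop_exit (not_holds_nonempty rfl)
  | succ m ih =>
    refine (Runs.loop_step (holds_nonempty rfl)
      ((Runs.pop 0).seq ((Runs.push 5 .one).seq (Runs.push 6 .one)))
      (ih (Tok.one :: a5) (Tok.one :: a6))).congr ?_ (by omega)
    rw [ones_append_cons, ones_append_cons]
    rfl

/-- Multiplies register 6 by register 0. -/
def mulProg : Prog :=
  .seq (moveOnes 6 4) (.loop (.nonempty 4) (.seq (.pop 4) (.seq addLoop (moveOnes 5 0))))

theorem runs_mulProg (n m : ℕ) (a1 a2 a3 a7 a8 a9 : List Tok) :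
    Runs O mulProg ⟨ones n, a1, a2, a3, [], [], ones m, a7, a8, a9⟩
      ⟨ones n, a1, a2, a3, [], [], ones (m * n), a7, a8, a9⟩ (m * (7 * n + 7) + 2) := by
  have hloop (a : List Tok) :
      Runs O (.loop (.nonempty 4) (.seq (.pop 4) (.seq addLoop (moveOnes 5 0))))
        ⟨ones n, a1, a2, a3, ones m, [], a, a7, a8, a9⟩
        ⟨ones n, a1, a2, a3, [], [], ones (m * n) ++ a, a7, a8, a9⟩ (m * (7 * n + 4) + 1) := by
    induction m generalizing a with
    | zero => exact (Runs.loop_exit (not_holds_nonempty rfl)).congr (by simp) (by omega)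
    | succ m ih =>
      have hadd := runs_addLoop (O := O) n a1 a2 a3 (ones m) [] a a7 a8 a9
      have hmove := runs_moveOnes_5_0 (O := O) n [] a1 a2 a3 (ones m) (ones n ++ a) a7 a8 a9
      rw [List.append_nil] at hadd hmove
      refine (Runs.loop_step (holds_nonempty rfl) ((Runs.pop 4).seq (hadd.seq hmove))
        (ih (ones n ++ a))).congr ?_ (by rw [Nat.add_mul]; omega)
      rw [← List.append_assoc, List.replicate_append_replicate, Nat.succ_mul]
  have hmove := runs_moveOnes_6_4 (O := O) m (ones n) a1 a2 a3 [] [] a7 a8 a9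
  rw [List.append_nil] at hmove
  refine (hmove.seq (hloop [])).congr (by rw [List.append_nil]) ?_
  ring_nf
  omega

/-- Adds the constant `c` to register 6. -/
def addConst : ℕ → Prog
  | 0 => .skip
  | c + 1 => .seq (.push 6 .one) (addConst c)

theorem runs_addConst (c m : ℕ) (a0 a1 a2 a3 a4 a5 a7 a8 a9 : List Tok) :
    Runs O (addConst c) ⟨a0, a1, a2, a3, a4, a5, ones m, a7, a8, a9⟩
      ⟨a0, a1, a2, a3, a4, a5, ones (m + c), a7, a8, a9⟩ (c + 1) := by
  induction c generalizing m with
  | zero => exact Runs.skip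
  | succ c ih =>
    refine ((Runs.push 6 .one).seq (ih (m + 1))).congr ?_ (by omega)
    rw [show m + 1 + c = m + (c + 1) by omega]

/-- Horner's scheme: register 6 holds the value so far, multiplied by register 0 or increased by a
constant. The bound on the steps is built along with the program. -/
theorem exists_evalProg (q : Polynomial ℕ) :
    ∃ (P : Prog) (r : Polynomial ℕ), ∀ (O : List Tok → List Tok → Bool) (n : ℕ)
      (a1 a2 a3 a7 a8 a9 : List Tok),
      Runs O P ⟨ones n, a1, a2, a3, [], [], [], a7, a8, a9⟩
        ⟨ones n, a1, a2, a3, [], [], ones (q.eval n), a7, a8, a9⟩ (r.eval n) := by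
  induction q using Polynomial.recOnHorner with
  | M0 => exact ⟨.skip, 1, fun O n a1 a2 a3 a7 a8 a9 => Runs.skip.congr (by simp) (by simp)⟩
  | MC p c _ _ ih =>
    obtain ⟨P, r, h⟩ := ih
    refine ⟨.seq P (addConst c), r + Polynomial.C (c + 1), fun O n a1 a2 a3 a7 a8 a9 => ?_⟩
    refine ((h O n a1 a2 a3 a7 a8 a9).seq (runs_addConst c _ _ _ _ _ _ _ _ _ _)).congr ?_ ?_
    · simp
    · simp
  | MX p _ ih =>
    obtain ⟨P, r, h⟩ := ih
    refine ⟨.seq P mulProg, r + (p * (7 * Polynomial.X + 7) + 2), fun O n a1 a2 a3 a7 a8 a9 => ?_⟩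
    refine ((h O n a1 a2 a3 a7 a8 a9).seq (runs_mulProg _ _ _ _ _ _ _ _)).congr ?_ ?_
    · simp
    · simp

/-- Adds `D` times register 9 to register 6. -/
def addMulConst (D : ℕ) : Prog := .loop (.nonempty 9) (.seq (.pop 9) (addConst D))

theorem runs_addMulConst (D l m : ℕ) (a0 a1 a2 a3 a4 a5 a7 a8 : List Tok) :
    Runs O (addMulConst D) ⟨a0, a1, a2, a3, a4, a5, ones l, a7, a8, ones m⟩
      ⟨a0, a1, a2, a3, a4, a5, ones (l + m * D), a7, a8, []⟩ (m * (D + 3) + 1) := by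
  induction m generalizing l with
  | zero => exact (Runs.loop_exit (not_holds_nonempty rfl)).congr (by simp) (by omega)
  | succ m ih =>
    refine (Runs.loop_step (holds_nonempty rfl) ((Runs.pop 9).seq
      (runs_addConst D l a0 a1 a2 a3 a4 a5 a7 a8 (ones m))) (ih (l + D))).congr ?_ ?_
    · rw [show l + D + m * D = l + (m + 1) * D by ring]
    · rw [Nat.add_mul]
      omega

/-- Subtracts register 6 from register 7 and writes the excess to register 8. -/
def subProg : Prog :=
  .loop (.nonempty 6) (.seq (.pop 6) (.ite (.nonempty 7) (.pop 7) (.push 8 .one)))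

theorem runs_subProg (l m e : ℕ) (a0 a1 a2 a3 a4 a5 a9 : List Tok) :
    Runs O subProg ⟨a0, a1, a2, a3, a4, a5, ones l, ones m, ones e, a9⟩
      ⟨a0, a1, a2, a3, a4, a5, [], ones (m - l), ones (e + (l - m)), a9⟩ (4 * l + 1) := by
  induction l generalizing m e with
  | zero => exact (Runs.loop_exit (not_holds_nonempty rfl)).congr (by simp) (by omega)
  | succ l ih =>
    cases m with
    | zero =>
      refine (Runs.loop_step (holds_nonempty rfl) ((Runs.pop 6).seq
        (Runs.ite_neg (not_holds_nonempty rfl) (Runs.push 8 .one))) (ih 0 (e + 1))).congr ?_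
          (by omega)
      rw [show e + 1 + (l - 0) = e + (l + 1 - 0) by omega]
      simp
    | succ m =>
      refine (Runs.loop_step (holds_nonempty rfl) ((Runs.pop 6).seq
        (Runs.ite_pos (holds_nonempty rfl) (Runs.pop 7))) (ih m e)).congr ?_ (by omega)
      simp

/-- Comparison of the number in register 9 with the values of a polynomial at register 0. -/
theorem exists_compareProg (p : Polynomial ℚ) :
    ∃ (P : Prog) (r : Polynomial ℕ), ∀ (O : List Tok → List Tok → Bool) (n m : ℕ)
      (a1 a2 a3 : List Tok), m ≤ n → ∃ R' : Regs,
      Runs O P ⟨ones n, a1, a2, a3, [], [], [], [], [], ones m⟩ R' (r.eval n) ∧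
        ((m : ℚ) ≤ p.eval (n : ℚ) → R'.r0.head? = some Tok.tt) ∧
        (¬ (m : ℚ) ≤ p.eval (n : ℚ) → R'.r0.head? = some Tok.ff) := by
  obtain ⟨D, F, N, hD, h⟩ := p.exists_nat_sub
  obtain ⟨PF, rF, hF⟩ := exists_evalProg F
  obtain ⟨PN, rN, hN⟩ := exists_evalProg N
  -- Multiplying by the denominator `D` and moving the negative part across leaves a comparison of
  -- natural numbers.
  have hiff (n m : ℕ) : (m : ℚ) ≤ p.eval (n : ℚ) ↔ N.eval n + m * D ≤ F.eval n := by
    have hD' : (0 : ℚ) < D := by exact_mod_cast hD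
    have h1 := h n
    rw [← mul_le_mul_iff_right₀ hD', h1, le_sub_iff_add_le, ← Nat.cast_le (α := ℚ)]
    push_cast
    rw [add_comm, mul_comm]
  refine ⟨.seqs [PF, moveOnes 6 7, PN, addMulConst D, subProg,
    .ite (.nonempty 8) (.push 0 .ff) (.push 0 .tt)],
    rF + (3 * F + rN + (Polynomial.X * Polynomial.C (D + 3) +
      (4 * (N + Polynomial.X * Polynomial.C D) + 10))), fun O n m a1 a2 a3 hmn => ?_⟩
  have h1 := hF O n a1 a2 a3 [] [] (ones m)
  have h2 := runs_moveOnes_6_7 (O := O) (F.eval n) (ones n) a1 a2 a3 [] [] [] [] (ones m)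
  have h3 := hN O n a1 a2 a3 (ones (F.eval n)) [] (ones m)
  have h4 := runs_addMulConst (O := O) D (N.eval n) m (ones n) a1 a2 a3 [] [] (ones (F.eval n)) []
  have h5 := runs_subProg (O := O) (N.eval n + m * D) (F.eval n) 0 (ones n) a1 a2 a3 [] [] []
  rw [List.append_nil] at h2
  have hbound : rF.eval n + (3 * F.eval n + 1 + (rN.eval n + (m * (D + 3) + 1 +
      (4 * (N.eval n + m * D) + 1 + (1 + 1 + 1))))) ≤
      (rF + (3 * F + rN + (Polynomial.X * Polynomial.C (D + 3) +
        (4 * (N + Polynomial.X * Polynomial.C D) + 10)))).eval n := by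
    -- The bound `m ≤ n` makes the steps polynomial in `n` alone.
    have e1 : m * (D + 3) ≤ n * (D + 3) := Nat.mul_le_mul_right _ hmn
    have e2 : m * D ≤ n * D := Nat.mul_le_mul_right _ hmn
    simp only [Polynomial.eval_add, Polynomial.eval_mul, Polynomial.eval_X, Polynomial.eval_C,
      Polynomial.eval_ofNat]
    omega
  by_cases hle : N.eval n + m * D ≤ F.eval n
  · rw [show 0 + (N.eval n + m * D - F.eval n) = 0 by omega] at h5
    refine ⟨_, (h1.cons (h2.cons (h3.cons (h4.cons (h5.cons ((Runs.ite_neg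
      (not_holds_nonempty rfl) (Runs.push 0 .tt)).cons Runs.nil)))))).mono hbound, ?_, ?_⟩
    · exact fun _ => rfl
    · exact fun hn => absurd ((hiff n m).2 hle) hn
  · obtain ⟨d, hd⟩ : ∃ d, 0 + (N.eval n + m * D - F.eval n) = d + 1 :=
      ⟨N.eval n + m * D - F.eval n - 1, by omega⟩
    rw [hd] at h5
    refine ⟨_, (h1.cons (h2.cons (h3.cons (h4.cons (h5.cons ((Runs.ite_pos
      (holds_nonempty rfl) (Runs.push 0 .ff)).cons Runs.nil)))))).mono hbound, ?_, ?_⟩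
    · exact fun hn => absurd ((hiff n m).1 hn) hle
    · exact fun _ => rfl

/-! ### Greedy search for a minimal non-model -/

namespace PForm

/-- The conjunction of `f` with a list of literals. -/
def conjLits {V : Type} (ls : List (V × Bool)) (f : PForm V) : PForm V :=
  ls.foldr (fun l g => .and (lit l) g) f

theorem eval_conjLits {V : Type} (ls : List (V × Bool)) (f : PForm V) (s : V → Bool) :
    (conjLits ls f).eval s = true ↔ (∀ l ∈ ls, s l.1 = l.2) ∧ f.eval s = true := by
  induction ls with
  | nil => simp [conjLits]
  | cons l ls ih =>
    rw [List.forall_mem_cons, and_assoc, ← ih, ← eval_lit]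
    simp [conjLits, eval]

/-- The clause that excludes the states in which the variables `vs` hold. -/
def negClause {V : Type} (vs : List V) : List (V × Bool) := vs.map fun x => (x, false)

/-- `ls` gives values to the variables below `i` such that some model of `I` with these values is
no model of `φ`, and such that a variable is true only where this is necessary. `vs` lists the
true variables. -/
structure Greedy {n : ℕ} (φ I : PForm (Fin n)) (i : ℕ) (ls : List (Fin n × Bool))
    (vs : List (Fin n)) : Prop where
  lt : ∀ l ∈ ls, l.1.val < i
  total : ∀ x : Fin n, x.val < i → ∃ b, (x, b) ∈ ls
  mem_vs : ∀ x, x ∈ vs ↔ (x, true) ∈ ls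
  sat : ∃ σ, φ.eval σ = false ∧ (conjLits ls I).eval σ = true
  least : ∀ x, (x, true) ∈ ls → ∀ s, (∀ l ∈ ls, l.1 < x → s l.1 = l.2) → s x = false →
    I.eval s = true → φ.eval s = true

namespace Greedy

variable {n : ℕ} {φ I : PForm (Fin n)}

theorem nil (h : ¬ I.Entails φ) : Greedy φ I 0 [] [] where
  lt := by simp
  total := by simp
  mem_vs := by simp
  sat := by
    simp only [Entails] at h
    push Not at h
    obtain ⟨s, hs, hφ⟩ := h
    exact ⟨s, by simpa using hφ, hs⟩
  least := by simp

variable {i : Fin n} {ls : List (Fin n × Bool)} {vs : List (Fin n)}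

theorem total_cons (h : Greedy φ I i ls vs) (b : Bool) (x : Fin n) (hx : x.val < i + 1) :
    ∃ b', (x, b') ∈ (i, b) :: ls := by
  by_cases hxi : x = i
  · exact ⟨b, by simp [hxi]⟩
  · obtain ⟨b', hb'⟩ := h.total x (by
      have : x.val ≠ i.val := fun h => hxi (Fin.ext h)
      omega)
    exact ⟨b', List.mem_cons_of_mem _ hb'⟩

/-- A state outside `φ` with the variable off still exists, so the variable is switched off and no
minimality claim is added. -/
theorem cons_false (h : Greedy φ I i ls vs) (hi : ¬ (conjLits ((i, false) :: ls) I).Entails φ) :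
    Greedy φ I (i + 1) ((i, false) :: ls) vs where
  lt := by
    rw [List.forall_mem_cons]
    exact ⟨Nat.lt_succ_self _, fun l hl => (h.lt l hl).trans (Nat.lt_succ_self _)⟩
  total := h.total_cons false
  mem_vs x := by rw [h.mem_vs]; simp
  sat := by
    simp only [Entails] at hi
    push Not at hi
    obtain ⟨s, hs, hφ⟩ := hi
    exact ⟨s, by simpa using hφ, hs⟩
  least x hx s hs := by
    refine h.least x (by simpa using hx) s fun l hl => hs l (List.mem_cons_of_mem _ hl)

/-- Every state with the variable off is now a model of `φ`. This forces the old witness to have it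
on, and it is also the minimality claim for the new variable. -/
theorem cons_true (h : Greedy φ I i ls vs) (hi : (conjLits ((i, false) :: ls) I).Entails φ) :
    Greedy φ I (i + 1) ((i, true) :: ls) (vs ++ [i]) where
  lt := by
    rw [List.forall_mem_cons]
    exact ⟨Nat.lt_succ_self _, fun l hl => (h.lt l hl).trans (Nat.lt_succ_self _)⟩
  total := h.total_cons true
  mem_vs x := by
    rw [List.mem_append, h.mem_vs, List.mem_singleton, List.mem_cons, Prod.mk.injEq]
    tauto
  sat := by
    obtain ⟨σ, hσ, hls⟩ := h.sat
    refine ⟨σ, hσ, ?_⟩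
    rw [eval_conjLits] at hls ⊢
    refine ⟨List.forall_mem_cons.2 ⟨?_, hls.1⟩, hls.2⟩
    by_contra hσi
    have := hi σ ((eval_conjLits _ _ _).2
      ⟨List.forall_mem_cons.2 ⟨by simpa using hσi, hls.1⟩, hls.2⟩)
    simp_all
  least x hx s hs hsx hsI := by
    rcases List.mem_cons.1 hx with heq | hx
    · obtain rfl : x = i := (Prod.mk.injEq _ _ _ _ ▸ heq).1
      refine hi s ((eval_conjLits _ _ _).2 ⟨List.forall_mem_cons.2 ⟨hsx, fun l hl => ?_⟩, hsI⟩)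
      exact hs l (List.mem_cons_of_mem _ hl) (h.lt l hl)
    · exact h.least x hx s (fun l hl => hs l (List.mem_cons_of_mem _ hl)) hsx hsI

/-- When all variables have values, the witness is determined by them. Switching off a true variable
`x` keeps the values below `x` and stays in `I`, so `least` gives a model of `φ`. This is why
`least` fixes only the smaller variables. -/
theorem exists_minFalse (h : Greedy φ I n ls vs) (hI : I.IsAntitone) :
    ∃ τ, φ.MinFalse τ ∧ I.eval τ = true ∧ ∀ x, x ∈ vs ↔ τ x = true := by
  obtain ⟨σ, hσ, hls⟩ := h.sat
  rw [eval_conjLits] at hls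
  have hmem (x : Fin n) : (x, σ x) ∈ ls := by
    obtain ⟨b, hb⟩ := h.total x x.isLt
    have : σ x = b := hls.1 _ hb
    rwa [this]
  have hle (x : Fin n) : Function.update σ x false ≤ σ := by
    intro y
    by_cases hy : y = x
    · subst hy; simp
    · simp [hy]
  refine ⟨σ, ⟨hσ, fun x hx => ?_⟩, hls.2, fun x => ?_⟩
  · refine h.least x (by rw [← hx]; exact hmem x) _ (fun l hl hlx => ?_) (by simp)
      (hI _ _ (hle x) hls.2)
    rw [Function.update_of_ne hlx.ne]
    exact hls.1 l hl
  · rw [h.mem_vs]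
    constructor
    · exact fun hx => hls.1 _ hx
    · exact fun hx => by rw [← hx]; exact hmem x

end Greedy

theorem eval_negClause {V : Type} {vs : List V} {τ : V → Bool} (h : ∀ x, x ∈ vs ↔ τ x = true)
    (s : V → Bool) : (∃ l ∈ negClause vs, s l.1 = l.2) ↔ ¬ τ ≤ s := by
  have : τ ≤ s ↔ ∀ x ∈ vs, s x = true := by
    constructor
    · intro hle x hx
      have := hle x
      rw [(h x).1 hx] at this
      exact top_le_iff.1 this
    · intro hs x
      cases hx : τ x
      · exact Bool.false_le _
      · rw [hs x ((h x).2 hx)]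
  rw [this]
  simp [negClause]

end PForm

/-! ### The program -/

/-- The encoding of the clause excluding `vs`, without the final `Tok.ff`. -/
def clauseTokens {n : ℕ} (vs : List (Fin n)) : List Tok :=
  vs.flatMap fun x : Fin n => Tok.or :: Tok.neg :: (ones x ++ [Tok.var])

theorem encode_negClause {n : ℕ} (vs : List (Fin n)) :
    (PForm.disj ((PForm.negClause vs).map PForm.lit)).encode = clauseTokens vs ++ [Tok.ff] := by
  induction vs with
  | nil => rfl
  | cons x vs ih =>
    simp only [PForm.negClause, List.map_cons, PForm.disj, PForm.encode, PForm.lit] at ih ⊢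
    rw [ih]
    simp [clauseTokens, PForm.encode]

/-- Register 7 is a stack, so a clause built there literal by literal is stored backwards. -/
theorem reverse_clauseTokens_append {n : ℕ} (vs : List (Fin n)) (x : Fin n) :
    (clauseTokens (vs ++ [x])).reverse =
      Tok.var :: (ones x ++ Tok.neg :: Tok.or :: (clauseTokens vs).reverse) := by
  simp [clauseTokens]

/-- Writes the number in register 4 to the registers 3 and 6. -/
def writeIndexQuery : Prog :=
  .seq (.loop (.nonempty 4) (.seq (.pop 4) (.seq (.push 5 .one) (.seq (.push 3 .one)
    (.push 6 .one))))) (moveOnes 5 4)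

theorem runs_writeIndexQuery (m : ℕ) (a0 a1 a2 a3 a6 a7 a8 a9 : List Tok) :
    Runs O writeIndexQuery ⟨a0, a1, a2, a3, ones m, [], a6, a7, a8, a9⟩
      ⟨a0, a1, a2, ones m ++ a3, ones m, [], ones m ++ a6, a7, a8, a9⟩ (8 * m + 2) := by
  have hloop (a : List Tok) : Runs O (.loop (.nonempty 4) (.seq (.pop 4) (.seq (.push 5 .one)
      (.seq (.push 3 .one) (.push 6 .one))))) ⟨a0, a1, a2, a3, ones m, a, a6, a7, a8, a9⟩
      ⟨a0, a1, a2, ones m ++ a3, [], ones m ++ a, ones m ++ a6, a7, a8, a9⟩ (5 * m + 1) := by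
    induction m generalizing a a3 a6 with
    | zero => exact Runs.loop_exit (not_holds_nonempty rfl)
    | succ m ih =>
      refine (Runs.loop_step (holds_nonempty rfl) ((Runs.pop 4).seq ((Runs.push 5 .one).seq
        ((Runs.push 3 .one).seq (Runs.push 6 .one))))
        (ih (Tok.one :: a3) (Tok.one :: a6) (Tok.one :: a))).congr ?_ (by omega)
      rw [ones_append_cons, ones_append_cons, ones_append_cons]
      rfl
  have h1 := hloop []
  have h2 := runs_moveOnes_5_4 (O := O) m a0 a1 a2 (ones m ++ a3) [] (ones m ++ a6) a7 a8 a9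
  rw [List.append_nil] at h1 h2
  exact (h1.seq h2).mono (by omega)

/-- Writes the number in register 4 to register 7. -/
def writeIndexClause : Prog :=
  .seq (.loop (.nonempty 4) (.seq (.pop 4) (.seq (.push 5 .one) (.push 7 .one)))) (moveOnes 5 4)

theorem runs_writeIndexClause (m : ℕ) (a0 a1 a2 a3 a6 a7 a8 a9 : List Tok) :
    Runs O writeIndexClause ⟨a0, a1, a2, a3, ones m, [], a6, a7, a8, a9⟩
      ⟨a0, a1, a2, a3, ones m, [], a6, ones m ++ a7, a8, a9⟩ (7 * m + 2) := by
  have hloop (a : List Tok) : Runs O (.loop (.nonempty 4) (.seq (.pop 4) (.seq (.push 5 .one)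
      (.push 7 .one)))) ⟨a0, a1, a2, a3, ones m, a, a6, a7, a8, a9⟩
      ⟨a0, a1, a2, a3, [], ones m ++ a, a6, ones m ++ a7, a8, a9⟩ (4 * m + 1) := by
    induction m generalizing a a7 with
    | zero => exact Runs.loop_exit (not_holds_nonempty rfl)
    | succ m ih =>
      refine (Runs.loop_step (holds_nonempty rfl) ((Runs.pop 4).seq ((Runs.push 5 .one).seq
        (Runs.push 7 .one))) (ih (Tok.one :: a7) (Tok.one :: a))).congr ?_ (by omega)
      rw [ones_append_cons, ones_append_cons]
      rfl
  have h1 := hloop []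
  have h2 := runs_moveOnes_5_4 (O := O) m a0 a1 a2 a3 [] a6 (ones m ++ a7) a8 a9
  rw [List.append_nil] at h1 h2
  exact (h1.seq h2).mono (by omega)

theorem holds_top {s : Store} {r : ℕ} {t : Tok} {l : List Tok} (h : s r = t :: l) :
    (Test.top r t).Holds s := by
  simp [Test.Holds, h]

theorem not_holds_top {s : Store} {r : ℕ} {t t' : Tok} {l : List Tok} (h : s r = t' :: l)
    (ht : t' ≠ t) : ¬ (Test.top r t).Holds s := by
  simp [Test.Holds, h, ht]

/-- Removes the literals of the last query from the formula in register 3. -/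
def restoreQuery : Prog := .loop (.nonempty 6) (.seq (.pop 6) (.pop 3))

/-- Register 6 counts the tokens that the search has put on top of the learned formula. -/
theorem runs_restoreQuery (pre a0 a1 a2 a3 a4 a5 a7 a8 a9 : List Tok) :
    Runs O restoreQuery ⟨a0, a1, a2, pre ++ a3, a4, a5, ones pre.length, a7, a8, a9⟩
      ⟨a0, a1, a2, a3, a4, a5, [], a7, a8, a9⟩ (3 * pre.length + 1) := by
  induction pre with
  | nil => exact Runs.loop_exit (not_holds_nonempty rfl)
  | cons t pre ih =>
    refine (Runs.loop_step (holds_nonempty rfl) ((Runs.pop 6).seq (Runs.pop 3)) ih).mono ?_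
    simp only [List.length_cons]
    omega

/-- Pushes the top of register 7 onto register 3 if it is in the list. -/
def copyTop : List Tok → Prog
  | [] => .skip
  | t :: ts => .ite (.top 7 t) (.push 3 t) (copyTop ts)

theorem runs_copyTop {ts : List Tok} {t : Tok} (ht : t ∈ ts)
    (a0 a1 a2 a3 a4 a5 a6 a7 a8 a9 : List Tok) :
    Runs O (copyTop ts) ⟨a0, a1, a2, a3, a4, a5, a6, t :: a7, a8, a9⟩
      ⟨a0, a1, a2, t :: a3, a4, a5, a6, t :: a7, a8, a9⟩ (ts.length + 1) := by
  induction ts with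
  | nil => simp at ht
  | cons u ts ih =>
    by_cases h : u = t
    · subst h
      have hc : (Test.top 7 u).Holds (Regs.mk a0 a1 a2 a3 a4 a5 a6 (u :: a7) a8 a9).get := rfl
      exact (Runs.ite_pos hc (Runs.push 3 u)).mono (by simp)
    · refine (Runs.ite_neg (fun hc => h ?_) (ih ?_)).mono (by simp)
      · exact (Option.some.inj hc).symm
      · exact (List.mem_cons.1 ht).resolve_left fun h' => h h'.symm

/-- Moves the clause in register 7 to register 3. -/
def moveClause : Prog :=
  .loop (.nonempty 7) (.seq (copyTop [.tt, .ff, .var, .one, .neg, .and, .or, .imp]) (.pop 7))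

theorem runs_moveClause (a0 a1 a2 a3 a4 a5 a6 a7 a8 a9 : List Tok) :
    Runs O moveClause ⟨a0, a1, a2, a3, a4, a5, a6, a7, a8, a9⟩
      ⟨a0, a1, a2, a7.reverse ++ a3, a4, a5, a6, [], a8, a9⟩ (11 * a7.length + 1) := by
  induction a7 generalizing a3 with
  | nil => exact Runs.loop_exit (not_holds_nonempty rfl)
  | cons t a7 ih =>
    refine (Runs.loop_step (holds_nonempty rfl) ((runs_copyTop (t := t) (by cases t <;> simp)
      _ _ _ _ _ _ _ _ _ _).seq (Runs.pop 7)) (ih (t :: a3))).congr ?_ ?_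
    · simp
    · simp only [List.length_cons, List.length_nil]
      omega

/-- Makes the literal last written to register 3 positive and adds the variable to the clause. -/
def keepVar : Prog :=
  -- The tokens `and`, `neg` on top of register 3 give way to a single `and`, so the count in
  -- register 6 drops by one.
  .seqs [.pop 3, .pop 3, .pop 6, .push 3 .and, .push 7 .or, .push 7 .neg, writeIndexClause,
    .push 7 .var]

theorem runs_keepVar (m : ℕ) (t t' t'' : Tok) (a0 a1 a2 a3 a6 a7 a8 a9 : List Tok) :
    Runs O keepVar ⟨a0, a1, a2, t :: t' :: a3, ones m, [], t'' :: a6, a7, a8, a9⟩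
      ⟨a0, a1, a2, Tok.and :: a3, ones m, [], a6,
        Tok.var :: (ones m ++ Tok.neg :: Tok.or :: a7), a8, a9⟩ (7 * m + 10) := by
  apply Runs.mono
  · eapply Runs.cons (Runs.pop 3)
    eapply Runs.cons (Runs.pop 3)
    eapply Runs.cons (Runs.pop 6)
    eapply Runs.cons (Runs.push 3 .and)
    eapply Runs.cons (Runs.push 7 .or)
    eapply Runs.cons (Runs.push 7 .neg)
    simp only [Regs.set_mk, Regs.get_mk, List.tail_cons]
    eapply Runs.cons (runs_writeIndexClause _ _ _ _ _ _ _ _ _)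
    exact (Runs.push 7 .var).cons Runs.nil
  · omega

/-- Fixes the value of the next variable. -/
def fixVar : Prog :=
  -- The top of the stack is the head of the word, so the literal in prefix notation is pushed from
  -- its end.
  .seqs [.push 3 .var, .push 6 .one, writeIndexQuery, .push 3 .neg, .push 6 .one, .push 3 .and,
    .push 6 .one, .query 3 2 8,
    .ite (.top 8 .tt) keepVar .skip,
    .pop 8, .pop 0, .push 4 .one]

theorem runs_fixVar_true (m : ℕ) {a2 a3 : List Tok} (a0 a1 a6 a7 a9 : List Tok)
    (h : O (Tok.and :: Tok.neg :: (ones m ++ Tok.var :: a3)) a2 = true) :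
    Runs O fixVar ⟨Tok.one :: a0, a1, a2, a3, ones m, [], a6, a7, [], a9⟩
      ⟨a0, a1, a2, Tok.and :: (ones m ++ Tok.var :: a3), ones (m + 1), [],
        Tok.one :: (ones m ++ Tok.one :: a6), Tok.var :: (ones m ++ Tok.neg :: Tok.or :: a7), [],
        a9⟩ (15 * m + 25) := by
  apply Runs.mono
  · eapply Runs.cons (Runs.push 3 .var)
    eapply Runs.cons (Runs.push 6 .one)
    simp only [Regs.set_mk, Regs.get_mk]
    eapply Runs.cons (runs_writeIndexQuery _ _ _ _ _ _ _ _ _)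
    eapply Runs.cons (Runs.push 3 .neg)
    eapply Runs.cons (Runs.push 6 .one)
    eapply Runs.cons (Runs.push 3 .and)
    eapply Runs.cons (Runs.push 6 .one)
    eapply Runs.cons (Runs.query 3 2 8)
    simp only [Regs.set_mk, Regs.get_mk]
    rw [if_pos h]
    eapply Runs.cons
    · eapply Runs.ite_pos
      · exact holds_top rfl
      · exact runs_keepVar m _ _ _ _ _ _ _ _ _ _ _
    eapply Runs.cons (Runs.pop 8)
    eapply Runs.cons (Runs.pop 0)
    exact (Runs.push 4 .one).cons Runs.nil
  · omega

theorem runs_fixVar_false (m : ℕ) {a2 a3 : List Tok} (a0 a1 a6 a7 a9 : List Tok)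
    (h : ¬ O (Tok.and :: Tok.neg :: (ones m ++ Tok.var :: a3)) a2 = true) :
    Runs O fixVar ⟨Tok.one :: a0, a1, a2, a3, ones m, [], a6, a7, [], a9⟩
      ⟨a0, a1, a2, Tok.and :: Tok.neg :: (ones m ++ Tok.var :: a3), ones (m + 1), [],
        Tok.one :: Tok.one :: (ones m ++ Tok.one :: a6), a7, [], a9⟩ (15 * m + 25) := by
  apply Runs.mono
  · eapply Runs.cons (Runs.push 3 .var)
    eapply Runs.cons (Runs.push 6 .one)
    simp only [Regs.set_mk, Regs.get_mk]
    eapply Runs.cons (runs_writeIndexQuery _ _ _ _ _ _ _ _ _)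
    eapply Runs.cons (Runs.push 3 .neg)
    eapply Runs.cons (Runs.push 6 .one)
    eapply Runs.cons (Runs.push 3 .and)
    eapply Runs.cons (Runs.push 6 .one)
    eapply Runs.cons (Runs.query 3 2 8)
    simp only [Regs.set_mk, Regs.get_mk]
    rw [if_neg h]
    eapply Runs.cons
    · eapply Runs.ite_neg
      · exact not_holds_top rfl Tok.noConfusion
      · exact Runs.skip
    eapply Runs.cons (Runs.pop 8)
    eapply Runs.cons (Runs.pop 0)
    exact (Runs.push 4 .one).cons Runs.nil
  · omega

theorem wordOracle_encode {n : ℕ} (δ : PForm (Fin n ⊕ Fin n)) (α β : PForm (Fin n)) :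
    wordOracle δ α.encode β.encode = hoareOracle δ (α, β) := by
  have : (∀ α' β' : PForm (Fin n), α'.encode = α.encode → β'.encode = β.encode →
      hoareOracle δ (α', β') = true) ↔ hoareOracle δ (α, β) = true := by
    constructor
    · exact fun h => h α β rfl rfl
    · intro h α' β' hα hβ
      rwa [PForm.encode_injective hα, PForm.encode_injective hβ]
  rw [Bool.eq_iff_iff, ← this]
  simp [wordOracle]

theorem encode_conjLits_true {n : ℕ} (x : Fin n) (ls : List (Fin n × Bool)) (f : PForm (Fin n)) :
    (PForm.conjLits ((x, true) :: ls) f).encode =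
      Tok.and :: (ones x ++ Tok.var :: (PForm.conjLits ls f).encode) := by
  simp [PForm.conjLits, PForm.lit, PForm.encode]

theorem encode_conjLits_false {n : ℕ} (x : Fin n) (ls : List (Fin n × Bool)) (f : PForm (Fin n)) :
    (PForm.conjLits ((x, false) :: ls) f).encode =
      Tok.and :: Tok.neg :: (ones x ++ Tok.var :: (PForm.conjLits ls f).encode) := by
  simp [PForm.conjLits, PForm.lit, PForm.encode]

/-- The registers during the greedy search, after `i` variables. -/
def SearchInv {n : ℕ} (φ bad I : PForm (Fin n)) (a1 a9 : List Tok) (i : ℕ) (R : Regs) : Prop :=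
  ∃ ls vs pre, PForm.Greedy φ I i ls vs ∧ i ≤ n ∧
    -- A variable adds fewer than `n` ones and at most three further tokens to the query, and
    -- likewise to the clause.
    (PForm.conjLits ls I).encode = pre ++ I.encode ∧ pre.length ≤ i * (n + 3) ∧
    (clauseTokens vs).length ≤ i * (n + 3) ∧
    R = ⟨ones (n - i), a1, bad.neg.encode, pre ++ I.encode, ones i, [], ones pre.length,
      (clauseTokens vs).reverse, [], a9⟩

theorem ones_length_eq (m l : ℕ) :
    Tok.one :: (ones m ++ Tok.one :: ones l) = ones (m + l + 2) := by
  rw [ones_append_cons, List.replicate_append_replicate]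
  rfl

theorem runs_fixVar {n : ℕ} {φ bad I : PForm (Fin n)} (hb : φ.Entails bad.neg)
    (hbad : ∃ s, bad.eval s = true) {a1 a9 : List Tok} {i : ℕ} {R : Regs}
    (h : SearchInv φ bad I a1 a9 i R) (hi : i < n) :
    ∃ R', Runs (wordOracle (maxTr φ)) fixVar R R' (15 * n + 25) ∧
      SearchInv φ bad I a1 a9 (i + 1) R' := by
  obtain ⟨ls, vs, pre, hg, -, henc, hpre, hcl, rfl⟩ := h
  have hn : ones (n - i) = Tok.one :: ones (n - (i + 1)) := by
    rw [show n - i = n - (i + 1) + 1 by omega]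
    rfl
  have hJe : (PForm.conjLits ((⟨i, hi⟩, false) :: ls) I).encode =
      Tok.and :: Tok.neg :: (ones i ++ Tok.var :: (pre ++ I.encode)) := by
    rw [encode_conjLits_false, henc]
  -- The query against `¬Bad` decides which of `cons_true` and `cons_false` applies.
  have hans : wordOracle (maxTr φ) (Tok.and :: Tok.neg :: (ones i ++ Tok.var :: (pre ++ I.encode)))
      bad.neg.encode = true ↔ (PForm.conjLits ((⟨i, hi⟩, false) :: ls) I).Entails φ := by
    rw [← hJe, wordOracle_encode, hoareOracle_eq_true, hoareValid_maxTr_neg_bad hb hbad]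
  rw [hn]
  by_cases hent : (PForm.conjLits ((⟨i, hi⟩, false) :: ls) I).Entails φ
  · refine ⟨_, (runs_fixVar_true i _ _ _ _ _ (hans.2 hent)).mono (by omega),
      (⟨i, hi⟩, true) :: ls, vs ++ [⟨i, hi⟩], Tok.and :: (ones i ++ Tok.var :: pre),
      hg.cons_true hent, hi, ?_, ?_, ?_, ?_⟩
    · rw [encode_conjLits_true, henc]
      simp
    · simp only [List.length_cons, List.length_append, List.length_replicate, Nat.add_mul]
      omega
    · rw [← List.length_reverse, reverse_clauseTokens_append]
      simp only [List.length_cons, List.length_append, List.length_replicate, Nat.add_mul,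
        List.length_reverse]
      omega
    · rw [reverse_clauseTokens_append, ones_length_eq]
      simp [Nat.add_assoc]
  · refine ⟨_, (runs_fixVar_false i _ _ _ _ _ (mt hans.1 hent)).mono (by omega),
      (⟨i, hi⟩, false) :: ls, vs, Tok.and :: Tok.neg :: (ones i ++ Tok.var :: pre),
      hg.cons_false hent, hi, ?_, ?_, ?_, ?_⟩
    · rw [encode_conjLits_false, henc]
      simp
    · simp only [List.length_cons, List.length_append, List.length_replicate, Nat.add_mul]
      omega
    · rw [Nat.add_mul]
      omega
    · rw [ones_length_eq]
      simp [Nat.add_assoc]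
      rfl

theorem runs_search {n : ℕ} {φ bad I : PForm (Fin n)} (hb : φ.Entails bad.neg)
    (hbad : ∃ s, bad.eval s = true) (hI : ¬ I.Entails φ) (a1 a9 : List Tok) :
    ∃ R', Runs (wordOracle (maxTr φ)) (.loop (.nonempty 0) fixVar)
      ⟨ones n, a1, bad.neg.encode, I.encode, [], [], [], [], [], a9⟩ R'
        (n * (15 * n + 26) + 1) ∧ SearchInv φ bad I a1 a9 n R' := by
  have hstep (i : ℕ) (R : Regs) (hR : SearchInv φ bad I a1 a9 i R)
      (hc : (Test.nonempty 0).Holds R.get) : i < n ∧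
      ∃ R', Runs (wordOracle (maxTr φ)) fixVar R R' (15 * n + 25) ∧
        SearchInv φ bad I a1 a9 (i + 1) R' := by
    have hlt : i < n := by
      obtain ⟨_, _, _, _, _, _, _, _, rfl⟩ := hR
      by_contra hne
      rw [show n - i = 0 by omega] at hc
      exact hc rfl
    exact ⟨hlt, runs_fixVar hb hbad hR hlt⟩
  obtain ⟨i, R', hrun, hinv, hexit⟩ := Runs.loop_of_invariant (SearchInv φ bad I a1 a9) n hstep
    ⟨[], [], [], .nil hI, by omega, rfl, by simp, by simp [clauseTokens], rfl⟩
  refine ⟨R', hrun, ?_⟩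
  have hle : i = n := by
    obtain ⟨_, _, _, _, hin, _, _, _, rfl⟩ := hinv
    by_contra hne
    refine hexit ?_
    rw [show n - i = n - (i + 1) + 1 by omega]
    exact holds_nonempty rfl
  rwa [hle] at hinv

/-- Adds the clause of a minimal non-model to the formula in register 3. -/
def learnClause : Prog :=
  .seqs [.pop 8, .loop (.nonempty 0) fixVar, moveOnes 4 0, restoreQuery, .push 7 .ff, moveClause,
    .push 3 .and, .push 9 .one, .query 3 2 8]

/-- The token for a truth value. -/
def boolTok (b : Bool) : Tok := if b = true then Tok.tt else Tok.ff

/-- The registers after `j` clauses have been learned. -/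
def LearnInv {n : ℕ} (φ bad : PForm (Fin n)) (a1 : List Tok) (j : ℕ) (R : Regs) : Prop :=
  ∃ (L : List (Fin n → Bool)) (cs : List (List (Fin n × Bool))), L.Nodup ∧
    (∀ τ ∈ L, φ.MinFalse τ) ∧ L.length = j ∧ cs.length = j ∧
    (∀ s, (PForm.ofClauses cs).eval s = true ↔ ∀ τ ∈ L, ¬ τ ≤ s) ∧
    R = ⟨ones n, a1, bad.neg.encode, (PForm.ofClauses cs).encode, [], [], [], [],
      [boolTok (hoareOracle (maxTr φ) (PForm.ofClauses cs, bad.neg))], ones j⟩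

/-- The answer `ff` means that `I` does not entail `φ`. As `I` excludes upward closed sets it is
antitone, and the search yields a minimal non-model satisfying `I`, which is therefore not yet in
the list. -/
theorem runs_learnClause {n : ℕ} {φ bad : PForm (Fin n)} (hb : φ.Entails bad.neg)
    (hbad : ∃ s, bad.eval s = true) {a1 : List Tok} {j : ℕ} {R : Regs}
    (h : LearnInv φ bad a1 j R) (hc : (Test.top 8 .ff).Holds R.get) :
    ∃ R', Runs (wordOracle (maxTr φ)) learnClause R R' (29 * (n + 3) * (n + 3)) ∧
      LearnInv φ bad a1 (j + 1) R' := by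
  obtain ⟨L, cs, hL, hmin, hLj, hcs, heval, rfl⟩ := h
  set I := PForm.ofClauses cs with hI
  have hnot : ¬ I.Entails φ := by
    rw [← hoareValid_maxTr_neg_bad hb hbad, ← hoareOracle_eq_true]
    intro hq
    simp [Test.Holds, Regs.get, hq, boolTok] at hc
  have hIanti : I.IsAntitone := fun s t hst ht =>
    (heval s).2 fun τ hτ hle => (heval t).1 ht τ hτ (hle.trans hst)
  obtain ⟨R₁, hrun, ls, vs, pre, hg, -, henc, hpre, hcl, rfl⟩ :=
    runs_search hb hbad hnot a1 (ones j)
  obtain ⟨τ, hτ, hIτ, hvs⟩ := hg.exists_minFalse hIanti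
  have henc' : (PForm.ofClauses (PForm.negClause vs :: cs)).encode =
      Tok.and :: (clauseTokens vs ++ Tok.ff :: I.encode) := by
    have : PForm.ofClauses (PForm.negClause vs :: cs) =
      .and (PForm.disj ((PForm.negClause vs).map PForm.lit)) I := rfl
    rw [this, PForm.encode, encode_negClause]
    simp
  refine ⟨⟨ones n, a1, bad.neg.encode, (PForm.ofClauses (PForm.negClause vs :: cs)).encode,
    [], [], [], [],
    [boolTok (hoareOracle (maxTr φ) (PForm.ofClauses (PForm.negClause vs :: cs), bad.neg))],
    ones (j + 1)⟩, ?_, τ :: L, PForm.negClause vs :: cs,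
    List.nodup_cons.2 ⟨fun hmem => (heval τ).1 hIτ τ hmem le_rfl, hL⟩,
    List.forall_mem_cons.2 ⟨hτ, hmin⟩, by simp [hLj], by simp [hcs], fun s => ?_, rfl⟩
  · rw [← wordOracle_encode (maxTr φ) (PForm.ofClauses (PForm.negClause vs :: cs)), henc']
    apply Runs.mono
    · eapply Runs.cons (Runs.pop 8)
      eapply Runs.cons hrun
      eapply Runs.cons (runs_moveOnes_4_0 _ _ _ _ _ _ _ _ _ _)
      eapply Runs.cons (runs_restoreQuery _ _ _ _ _ _ _ _ _ _)
      eapply Runs.cons (Runs.push 7 .ff)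
      simp only [Regs.set_mk, Regs.get_mk]
      eapply Runs.cons (runs_moveClause _ _ _ _ _ _ _ _ _ _)
      eapply Runs.cons (Runs.push 3 .and)
      eapply Runs.cons (Runs.push 9 .one)
      refine ((Runs.query 3 2 8).cons Runs.nil).congr ?_ le_rfl
      simp only [Regs.set_mk, Regs.get_mk]
      simp [boolTok, List.replicate_succ]
    -- The quadratic terms come from the search (15), the removal of the query literals (3) and the
    -- transfer of the clause (11), which makes 29.
    · simp only [List.length_cons, List.length_reverse]
      nlinarith
  · rw [PForm.eval_ofClauses, List.forall_mem_cons, List.forall_mem_cons,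
      PForm.eval_negClause hvs, ← heval, hI, PForm.eval_ofClauses]

/-! ### Minimal CNF length and correctness of the program -/

/-- A CNF of `φ` with exactly one clause for each listed minimal non-model is a shortest one, by
`PForm.length_le_of_minFalse`. -/
theorem hasShortInvariant_iff_of_minFalse {n : ℕ} {φ init bad : PForm (Fin n)} {p : Polynomial ℚ}
    (hanti : φ.IsAntitone) (hi : init.Entails φ) (hb : φ.Entails bad.neg)
    (hinit : ∃ s, init.eval s = true) (hbad : ∃ s, bad.eval s = true)
    {L : List (Fin n → Bool)} (hL : L.Nodup) (hmin : ∀ τ ∈ L, φ.MinFalse τ)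
    {cs : List (List (Fin n × Bool))} (hlen : cs.length = L.length)
    (hcs : ∀ s, (PForm.ofClauses cs).eval s = φ.eval s) :
    (TransSys.mk init (maxTr φ) bad).HasShortInvariant p ↔ (L.length : ℚ) ≤ p.eval (n : ℚ) := by
  constructor
  · rintro ⟨I, ⟨cs', hlen', rfl⟩, hinv⟩
    have hcs' := (isInvariant_maxTr_iff hi hb hinit hbad _).1 hinv
    exact le_trans (by exact_mod_cast PForm.length_le_of_minFalse hanti cs' hcs' L hL hmin) hlen'
  · intro h
    exact ⟨_, ⟨cs, by rwa [hlen], rfl⟩, (isInvariant_maxTr_iff hi hb hinit hbad _).2 hcs⟩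

/-- Learns all minimal non-models and compares their number by means of `Pcmp`. -/
def inferenceProg (Pcmp : Prog) : Prog :=
  -- The query `(Init, ¬Bad)` fails on the unsafe system and holds on the maximal ones. Register 2
  -- keeps `¬Bad` for all further queries.
  .seqs [.push 2 .neg, .query 1 2 8,
    .ite (.top 8 .tt)
      (.seqs [.pop 8, .push 3 .tt, .query 3 2 8, .loop (.top 8 .ff) learnClause, .pop 8, Pcmp])
      (.push 0 .ff)]

/-- The learned non-models are minimal and distinct, so there are at most as many as the `2k+1`
clauses allowed in `φ`. The bound on `j` also gives the `j ≤ n` that the comparison needs. -/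
theorem runs_learnLoop {k : ℕ} {φ : PForm (Fin (2 * k + 3))}
    (hmon : φ.IsMonCNF ((2 * k + 1 : ℕ) : ℚ)) (hb : φ.Entails (badK k).neg) (a1 : List Tok) :
    ∃ j R', Runs (wordOracle (maxTr φ)) (.loop (.top 8 .ff) learnClause)
      ⟨ones (2 * k + 3), a1, (badK k).neg.encode, [Tok.tt], [], [], [], [],
        [boolTok (hoareOracle (maxTr φ) (PForm.ofClauses [], (badK k).neg))], []⟩ R'
      ((2 * k + 1) * (29 * ((2 * k + 3) + 3) * ((2 * k + 3) + 3) + 1) + 1) ∧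
      LearnInv φ (badK k) a1 j R' ∧ ¬ (Test.top 8 .ff).Holds R'.get ∧ j ≤ 2 * k + 1 := by
  obtain ⟨cs, hlen, -, hφ⟩ := id hmon
  have hlen' : cs.length ≤ 2 * k + 1 := by exact_mod_cast hlen
  have hcs : ∀ s, (PForm.ofClauses cs).eval s = φ.eval s := fun s => by rw [hφ]
  have hle {L : List (Fin (2 * k + 3) → Bool)} (hL : L.Nodup) (hmin : ∀ τ ∈ L, φ.MinFalse τ) :
      L.length ≤ 2 * k + 1 :=
    (PForm.length_le_of_minFalse hmon.isAntitone cs hcs L hL hmin).trans hlen'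
  have hle' {j : ℕ} {R : Regs} (h : LearnInv φ (badK k) a1 j R) : j ≤ 2 * k + 1 := by
    obtain ⟨L, _, hL, hmin, hLj, -⟩ := h
    exact hLj ▸ hle hL hmin
  obtain ⟨j, R', hrun, hinv, hexit⟩ := Runs.loop_of_invariant (O := wordOracle (maxTr φ))
    (P := learnClause) (c := .top 8 .ff) (LearnInv φ (badK k) a1) (2 * k + 1)
    (fun j R hR hc => by
      obtain ⟨R', h1, h2⟩ := runs_learnClause hb (exists_eval_badK k) hR hc
      exact ⟨hle' h2, R', h1, h2⟩)
    ⟨[], [], List.nodup_nil, by simp, rfl, rfl, by simp [PForm.eval_ofClauses], rfl⟩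
  exact ⟨j, R', hrun, hinv, hexit, hle' hinv⟩

theorem get_eq_inputStore {n : ℕ} (T : TransSys n) :
    (Regs.mk (ones n) T.Init.encode T.Bad.encode [] [] [] [] [] [] []).get = inputStore T := by
  funext i
  by_cases hi : i < 10
  · interval_cases i <;> rfl
  · obtain ⟨m, rfl⟩ := Nat.exists_eq_add_of_le (not_lt.1 hi)
    rw [Nat.add_comm]
    rfl

theorem exists_decidesInPolyTime (p : Polynomial ℚ) : ∃ P : Prog, DecidesInPolyTime P p MonMaxSys := by
  obtain ⟨Pcmp, r, hcmp⟩ := exists_compareProg p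
  refine ⟨inferenceProg Pcmp, Polynomial.X * (29 * (Polynomial.X + 3) * (Polynomial.X + 3) + 1) +
    r + 12, fun n T hT => ?_⟩
  suffices H : ∃ (R' : Regs) (B : ℕ), Runs (wordOracle T.delta) (inferenceProg Pcmp)
      ⟨ones n, T.Init.encode, T.Bad.encode, [], [], [], [], [], [], []⟩ R' B ∧
      B ≤ n * (29 * (n + 3) * (n + 3) + 1) + r.eval n + 12 ∧
      (T.HasShortInvariant p → R'.r0.head? = some Tok.tt) ∧
      (¬ T.HasShortInvariant p → R'.r0.head? = some Tok.ff) by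
    obtain ⟨R', B, ⟨t, ht, hexec⟩, hB, h1, h2⟩ := H
    rw [get_eq_inputStore] at hexec
    refine ⟨_, t, hexec, ?_, h1, h2⟩
    simpa using ht.trans hB
  cases hT with
  | unsafeSys k =>
    have hq : wordOracle (n := 2 * k + 3) PForm.tru (initK k).encode (Tok.neg :: (badK k).encode) = false := by
      rw [← PForm.encode, wordOracle_encode, hoareOracle_eq_false]
      obtain ⟨s, hs⟩ := exists_eval_initK k
      obtain ⟨s', hs'⟩ := exists_eval_badK k
      exact ⟨s, s', hs, rfl, by simp [PForm.eval, hs']⟩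
    refine ⟨⟨Tok.ff :: ones (2 * k + 3), (initK k).encode, Tok.neg :: (badK k).encode, [], [], [],
      [], [], [Tok.ff], []⟩, 5, ?_, by omega,
      fun h => absurd h (not_hasShortInvariant_unsafe k p), fun _ => rfl⟩
    apply Runs.mono
    · eapply Runs.cons (Runs.push 2 .neg)
      eapply Runs.cons (Runs.query 1 2 8)
      simp only [Regs.set_mk, Regs.get_mk]
      rw [hq]
      exact (Runs.ite_neg (not_holds_top rfl (by simp)) (Runs.push 0 .ff)).cons
        Runs.nil
    · omega
  | maximal k φ hmon hi hb =>
    have hq : wordOracle (maxTr φ) (initK k).encode (Tok.neg :: (badK k).encode) = true := by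
      rw [← PForm.encode, wordOracle_encode, hoareOracle_eq_true,
        hoareValid_maxTr_neg_bad hb (exists_eval_badK k)]
      exact hi
    obtain ⟨j, R₁, hrun, ⟨L, cs, hL, hmin, hLj, hcsj, heval, rfl⟩, hexit, hj⟩ :=
      runs_learnLoop hmon hb (initK k).encode
    -- The loop has stopped, so the last answer was not `ff` and the learned clauses entail `φ`.
    have hent : (PForm.ofClauses cs).Entails φ := by
      rw [← hoareValid_maxTr_neg_bad hb (exists_eval_badK k), ← hoareOracle_eq_true]
      by_contra hf
      exact hexit (by simp [Test.Holds, Regs.get, boolTok, hf])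
    have hcs : ∀ s, (PForm.ofClauses cs).eval s = φ.eval s := fun s => by
      rw [Bool.eq_iff_iff]
      refine ⟨hent s, fun hs => (heval s).2 fun τ hτ hle => ?_⟩
      have := hmon.isAntitone.eq_false_of_le hle (hmin τ hτ).1
      simp_all
    obtain ⟨R', hrun', hyes, hno⟩ := hcmp (wordOracle (maxTr φ)) (2 * k + 3) j (initK k).encode
      (badK k).neg.encode (PForm.ofClauses cs).encode (by omega)
    have hiff := hasShortInvariant_iff_of_minFalse (p := p) hmon.isAntitone hi hb
      (exists_eval_initK k) (exists_eval_badK k) hL hmin (hcsj.trans hLj.symm) hcs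
    rw [hLj] at hiff
    refine ⟨R', _, ?_, le_rfl, fun h => hyes (hiff.1 h), fun h => hno (mt hiff.2 h)⟩
    apply Runs.mono
    · eapply Runs.cons (Runs.push 2 .neg)
      eapply Runs.cons (Runs.query 1 2 8)
      simp only [Regs.set_mk, Regs.get_mk]
      rw [hq]
      eapply Runs.cons
      · eapply Runs.ite_pos
        · exact holds_top rfl
        · eapply Runs.cons (Runs.pop 8)
          eapply Runs.cons (Runs.push 3 .tt)
          eapply Runs.cons (Runs.query 3 2 8)
          simp only [Regs.set_mk, Regs.get_mk, List.tail_cons]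
          rw [← wordOracle_encode] at hrun
          eapply Runs.cons hrun
          eapply Runs.cons (Runs.pop 8)
          exact hrun'.cons Runs.nil
      · exact Runs.nil
    · have : (2 * k + 1) * (29 * ((2 * k + 3) + 3) * ((2 * k + 3) + 3) + 1) ≤
          (2 * k + 3) * (29 * ((2 * k + 3) + 3) * ((2 * k + 3) + 3) + 1) :=
        Nat.mul_le_mul_right _ (by omega)
      omega

theorem mainTheorem2 (p : Polynomial ℚ)
    (hp : ∃ c : ℚ, 0 < c ∧ ∀ᶠ n : ℕ in Filter.atTop, c * n ≤ p.eval (n : ℚ)) :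
    (DecidesInference (pdr1Decide p) p MonMaxSys ∧
      ∃ r : Polynomial ℕ, ∀ n : ℕ,
        queryComplexity (pdr1Decide p) MonMaxSys n ≤ ((r.eval n : ℕ) : ℕ∞)) ∧
    (∃ P : Prog, DecidesInPolyTime P p MonMaxSys) ∧
    (∃ c : ℝ, 0 < c ∧ ∃ k₀ : ℕ, ∀ A : QueryAlg inductivenessModel,
      DecidesInference A p MonMaxSys → ∀ k : ℕ, k₀ ≤ k →
        (2 : ENNReal) ^ (c * ((2 * k + 3 : ℕ) : ℝ)) ≤
          ((queryComplexity A MonMaxSys (2 * k + 3) : ℕ∞) : ENNReal)) :=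
  ⟨⟨decidesInference_pdr1Decide p, exists_queryComplexity_pdr1Decide_le p⟩,
    exists_decidesInPolyTime p, inductiveness_lower_bound p hp⟩
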